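/- Let $a,b,s\in\mathbb{R}$ with $s\neq 0$; all functions and scalars are real, and $\mathbb N=\{0,1,2,\dots\}$. Let $H^1_{(1)}(0,1)=\{f\in H^1(0,1) : f(1)=0\}$ with inner product $\int_0^1 f_1'f_2'\,dx$, and let $\mathcal{H}^1=H^1_{(1)}(0,1)\times H^1(0,1)$ be the Hilbert space with inner product $$\langle (f_1,g_1),(f_2,g_2)\rangle=\int_0^1\left(f_1'f_2'+g_1g_2+g_1'g_2'\right)dx .$$ Put $\Delta=\{(n,m)\in\mathbb{N}^2 : 4(b-a)=(4m^2-(2n+1)^2)\pi^2\}$, $\Delta_1=\{n : \exists m,\ (n,m)\in\Delta\}$, $\Delta_2=\{m : \exists n,\ (n,m)\in\Delta\}$, $\lambda_{1,n}=a-(n+\tfrac12)^2\pi^2$, $\lambda_{2,m}=b-m^2\pi^2$, $\mu_0=1$ and $\mu_m=\sqrt2$ for $m\ge1$. For $n,m\ge0$ define the following pairs of functions on $(0,1)$. * $\varphi_{1,n}=\left(\sqrt2\cos((n+\tfrac12)\pi x),\,0\right)$ and $\varphi_{2,m}=\left(\varphi_{2,m}^1,\ \mu_m\cos(m\pi x)\right)$,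 where - if $m\in\Delta_2$ and $k$ is the unique integer with $(k,m)\in\Delta$, then $\varphi_{2,m}^1(x)=\frac{s\mu_m}{(k+1/2)\pi}(1-x)\sin((k+\tfrac12)\pi x)$; - if $m\notin\Delta_2$ and $b-a=m^2\pi^2$, then $\varphi_{2,m}^1(x)=s\mu_m(-1+x)$; - if $m\notin\Delta_2$ and $b-a\ne m^2\pi^2$, then $\varphi_{2,m}^1(x)=-\frac{s\mu_m}{r_m\cosh(r_m)}\sinh(r_m(1-x))$, where $r_m\in\mathbb{C}$ is either of the two square roots of $\lambda_{2,m}-a$ (this function is real-valued). * $\psi_{2,m}=\left(0,\ \mu_m\cos(m\pi x)\right)$ and $\psi_{1,n}=\left(\sqrt2\cos((n+\tfrac12)\pi x),\,\psi_{1,n}^2\right)$, where - if $n\notin\Delta_1$, then $\psi_{1,n}^2(x)=-\frac{\sqrt2 s}{r_n^*\sinh(r_n^*)}\cosh(r_n^*(1-x))$, where $r_n^*\in\mathbb{C}$ is either of the two square roots of $\lambda_{1,n}-b$ (this function is real-valued); - if $n\in\Delta_1$ and the unique integer $k$ with $(n,k)\in\Delta$ is $k=0$, then $\psi_{1,n}^2(x)=-s\sqrt2\left(\frac13+\frac1{(2n+1)^2\pi^2}\right)+\sqrt2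 s x-\frac{\sqrt2}{2}s x^2$; - if $n\in\Delta_1$ and this $k$ is $\ge1$, then $\psi_{1,n}^2(x)=\frac{\sqrt2 s}{k\pi}(1-x)\sin(k\pi x)-\frac{2s}{\pi^2}\left(\frac1{(2n+1)^2}+\frac1{4k^2}\right)\sqrt2\cos(k\pi x)$. Then each of the two families $$\left\{\tfrac{1}{(n+1/2)\pi}\varphi_{1,n}\right\}_{n\ge0}\cup\left\{\tfrac{1}{\sqrt{1+m^2\pi^2}}\varphi_{2,m}\right\}_{m\ge0},\qquad \left\{\tfrac{1}{(n+1/2)\pi}\psi_{1,n}\right\}_{n\ge0}\cup\left\{\tfrac{1}{\sqrt{1+m^2\pi^2}}\psi_{2,m}\right\}_{m\ge0}$$ is contained in $\mathcal{H}^1$ and is a Riesz basis of $\mathcal{H}^1$, that is, the image of a Hilbert (complete orthonormal) basis of $\mathcal{H}^1$ under a bounded linear bijection of $\mathcal{H}^1$ with bounded inverse. -/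

import Mathlib

namespace HeatCascade

open MeasureTheory Set Filter
open scoped ContDiff

/-! ### The Sobolev spaces on the interval `(0,1)` (real-valued functions) -/

/-- Lebesgue measure on `(0,1)`. -/
noncomputable abbrev unitMeasure : Measure ℝ := volume.restrict (Ioo (0 : ℝ) 1)

/-- The real Hilbert space `L²(0,1)`. -/
noncomputable abbrev L2 : Type := Lp ℝ 2 unitMeasure

/-- Test functions: smooth functions with compact support contained in `(0,1)`. -/
def IsTest (φ : ℝ → ℝ) : Prop :=
  ContDiff ℝ ∞ φ ∧ HasCompactSupport φ ∧ tsupport φ ⊆ Ioo (0 : ℝ) 1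

/-- `g ∈ L²(0,1)` is the weak derivative of `f ∈ L²(0,1)`. -/
def HasWeakDeriv (f g : L2) : Prop :=
  ∀ φ : ℝ → ℝ, IsTest φ →
    ∫ x in Ioo (0 : ℝ) 1, f x * deriv φ x = - ∫ x in Ioo (0 : ℝ) 1, g x * φ x

theorem IsTest.memLp {φ : ℝ → ℝ} (h : IsTest φ) : MemLp φ 2 unitMeasure :=
  (h.1.continuous.memLp_of_hasCompactSupport h.2.1).restrict _

theorem IsTest.memLp_deriv {φ : ℝ → ℝ} (h : IsTest φ) : MemLp (deriv φ) 2 unitMeasure :=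
  ((h.1.continuous_deriv (by simp)).memLp_of_hasCompactSupport h.2.1.deriv).restrict _

theorem integrable_mul_of_memLp (f : L2) {φ : ℝ → ℝ} (h : MemLp φ 2 unitMeasure) :
    Integrable (fun x => f x * φ x) unitMeasure :=
  (Lp.memLp f).integrable_mul h

theorem integral_add_mul (f g : L2) {φ : ℝ → ℝ} (h : MemLp φ 2 unitMeasure) :
    ∫ x in Ioo (0 : ℝ) 1, (f + g : L2) x * φ x =
      (∫ x in Ioo (0 : ℝ) 1, f x * φ x) + ∫ x in Ioo (0 : ℝ) 1, g x * φ x := by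
  rw [← integral_add (integrable_mul_of_memLp f h) (integrable_mul_of_memLp g h)]
  refine integral_congr_ae ?_
  filter_upwards [Lp.coeFn_add f g] with x hx
  rw [hx, Pi.add_apply, add_mul]

theorem integral_smul_mul (c : ℝ) (f : L2) (φ : ℝ → ℝ) :
    ∫ x in Ioo (0 : ℝ) 1, (c • f : L2) x * φ x =
      c * ∫ x in Ioo (0 : ℝ) 1, f x * φ x := by
  rw [← integral_const_mul]
  refine integral_congr_ae ?_
  filter_upwards [Lp.coeFn_smul c f] with x hx
  rw [hx, Pi.smul_apply, smul_eq_mul, mul_assoc]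

theorem HasWeakDeriv.add {f₁ g₁ f₂ g₂ : L2} (h₁ : HasWeakDeriv f₁ g₁)
    (h₂ : HasWeakDeriv f₂ g₂) : HasWeakDeriv (f₁ + f₂) (g₁ + g₂) := by
  intro φ hφ
  rw [integral_add_mul _ _ hφ.memLp_deriv, integral_add_mul _ _ hφ.memLp, h₁ φ hφ, h₂ φ hφ]
  ring

theorem HasWeakDeriv.smul (c : ℝ) {f g : L2} (h : HasWeakDeriv f g) :
    HasWeakDeriv (c • f) (c • g) := by
  intro φ hφ
  rw [integral_smul_mul, integral_smul_mul, h φ hφ]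
  ring

theorem HasWeakDeriv.zero : HasWeakDeriv 0 0 := by
  simpa using HasWeakDeriv.smul 0 (f := 0) (g := 0) (by
    intro φ hφ
    have h : ∀ ψ : ℝ → ℝ, ∫ x in Ioo (0 : ℝ) 1, (0 : L2) x * ψ x = 0 := by
      intro ψ
      simpa using integral_smul_mul 0 (0 : L2) ψ
    rw [h, h, neg_zero])

/-- The fundamental lemma of the calculus of variations on `(0,1)`. -/
theorem eq_zero_of_integral_test {u : ℝ → ℝ} (hu : Integrable u unitMeasure)
    (h : ∀ φ, IsTest φ → ∫ x in Ioo (0 : ℝ) 1, u x * φ x = 0) : u =ᵐ[unitMeasure] 0 := by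
  have key := isOpen_Ioo.ae_eq_zero_of_integral_contDiff_smul_eq_zero (μ := volume)
    (IntegrableOn.locallyIntegrableOn hu) (by
    intro φ h1 h2 h3
    rw [← h φ ⟨h1, h2, h3⟩]
    rw [← integral_indicator measurableSet_Ioo]
    refine integral_congr_ae (Eventually.of_forall fun x => ?_)
    by_cases hx : x ∈ Ioo (0 : ℝ) 1
    · simp [hx, mul_comm]
    · have : φ x = 0 := image_eq_zero_of_notMem_tsupport fun hh => hx (h3 hh)
      simp only [indicator_of_notMem hx, this, zero_smul])
  rw [EventuallyEq, ae_restrict_iff' measurableSet_Ioo]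
  exact key

theorem L2.integrable (f : L2) : Integrable f unitMeasure :=
  (Lp.memLp f).integrable (by norm_num)

theorem HasWeakDeriv.unique {f g₁ g₂ : L2} (h₁ : HasWeakDeriv f g₁)
    (h₂ : HasWeakDeriv f g₂) : g₁ = g₂ := by
  have h := h₁.add (h₂.smul (-1))
  rw [← sub_eq_zero, Lp.eq_zero_iff_ae_eq_zero]
  refine eq_zero_of_integral_test (L2.integrable _) ?_
  intro φ hφ
  have := h φ hφ
  have e : g₁ - g₂ = g₁ + (-1 : ℝ) • g₂ := by rw [neg_one_smul, sub_eq_add_neg]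
  have e' : f + (-1 : ℝ) • f = (0 : ℝ) • f := by rw [neg_one_smul, zero_smul]; abel
  rw [e', integral_smul_mul, zero_mul] at this
  rw [e]
  linarith

theorem IsTest.integrable {φ : ℝ → ℝ} (h : IsTest φ) : Integrable φ unitMeasure :=
  (h.1.continuous.integrable_of_hasCompactSupport h.2.1).restrict

theorem IsTest.integral_eq {φ : ℝ → ℝ} (h : IsTest φ) :
    ∫ x in Ioo (0 : ℝ) 1, φ x = ∫ x, φ x := by
  refine setIntegral_eq_integral_of_forall_compl_eq_zero fun x hx => ?_
  exact image_eq_zero_of_notMem_tsupport fun hh => hx (h.2.2 hh)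

/-- A test function of integral zero is the derivative of a test function. -/
theorem IsTest.exists_primitive {θ : ℝ → ℝ} (h : IsTest θ)
    (h0 : ∫ x in Ioo (0 : ℝ) 1, θ x = 0) : ∃ ψ, IsTest ψ ∧ deriv ψ = θ := by
  have hcont : Continuous θ := h.1.continuous
  obtain ⟨p, q, hp, hq, hout⟩ : ∃ p q : ℝ, 0 < p ∧ q < 1 ∧ ∀ x, x ∉ Icc p q → θ x = 0 := by
    rcases (tsupport θ).eq_empty_or_nonempty with he | hne
    · refine ⟨1 / 2, 1 / 2, by norm_num, by norm_num, fun x _ => ?_⟩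
      exact image_eq_zero_of_notMem_tsupport (by simp [he])
    · obtain ⟨p, hp⟩ := IsCompact.exists_isLeast (s := tsupport θ) h.2.1 hne
      obtain ⟨q, hq⟩ := IsCompact.exists_isGreatest (s := tsupport θ) h.2.1 hne
      exact ⟨p, q, (h.2.2 hp.1).1, (h.2.2 hq.1).2, fun x hx =>
        image_eq_zero_of_notMem_tsupport fun hh => hx ⟨hp.2 hh, hq.2 hh⟩⟩
  have hd : ∀ x, HasDerivAt (fun y => ∫ t in (0 : ℝ)..y, θ t) (θ x) x := fun x =>
    intervalIntegral.integral_hasDerivAt_right (hcont.intervalIntegrable _ _)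
      hcont.stronglyMeasurable.stronglyMeasurableAtFilter hcont.continuousAt
  have hderiv : deriv (fun y => ∫ t in (0 : ℝ)..y, θ t) = θ := funext fun x => (hd x).deriv
  have h01 : ∫ t in (0 : ℝ)..1, θ t = 0 := by
    rw [intervalIntegral.integral_of_le zero_le_one, integral_Ioc_eq_integral_Ioo, h0]
  have hvan : ∀ x, x ∉ Icc p q → ∫ t in (0 : ℝ)..x, θ t = 0 := by
    intro x hx
    rcases lt_or_ge x p with hxp | hxp
    · refine (intervalIntegral.integral_congr (g := fun _ => 0) fun t ht => ?_).trans (by simp)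
      refine hout t fun hh => ?_
      rcases le_total 0 x with h1 | h1
      · rw [uIcc_of_le h1] at ht
        linarith [ht.2, hh.1]
      · rw [uIcc_of_ge h1] at ht
        linarith [ht.2, hh.1]
    · have hxq : q < x := not_le.1 fun hh => hx ⟨hxp, hh⟩
      rw [← intervalIntegral.integral_add_adjacent_intervals
        (hcont.intervalIntegrable 0 1) (hcont.intervalIntegrable 1 x), h01, zero_add]
      refine (intervalIntegral.integral_congr (g := fun _ => 0) fun t ht => ?_).trans (by simp)
      refine hout t fun hh => ?_
      rcases le_total 1 x with h1 | h1
      · rw [uIcc_of_le h1] at ht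
        linarith [ht.1, hh.2]
      · rw [uIcc_of_ge h1] at ht
        linarith [ht.1, hh.2]
  have hsub : tsupport (fun y => ∫ t in (0 : ℝ)..y, θ t) ⊆ Icc p q :=
    closure_minimal (fun x hx => by_contra fun hh => hx (hvan x hh)) isClosed_Icc
  refine ⟨_, ⟨?_, ?_, ?_⟩, hderiv⟩
  · rw [contDiff_infty_iff_deriv, hderiv]
    exact ⟨fun x => (hd x).differentiableAt, h.1⟩
  · exact isCompact_Icc.of_isClosed_subset (isClosed_tsupport _) hsub
  · exact hsub.trans fun x hx => ⟨hp.trans_le hx.1, hx.2.trans_lt hq⟩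

/-- A function on `(0,1)` with vanishing weak derivative is constant. -/
theorem HasWeakDeriv.ae_const {f : L2} (h : HasWeakDeriv f 0) :
    ∃ c : ℝ, f =ᵐ[unitMeasure] fun _ => c := by
  let B : ContDiffBump (1 / 2 : ℝ) := ⟨1 / 8, 1 / 4, by norm_num, by norm_num⟩
  let η : ℝ → ℝ := B.normed volume
  have hη : IsTest η := by
    refine ⟨B.contDiff_normed, B.hasCompactSupport_normed, ?_⟩
    rw [B.tsupport_normed_eq, Real.closedBall_eq_Icc]
    intro x hx
    simp only [B, mem_Icc] at hx
    constructor <;> linarith [hx.1, hx.2]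
  have hηint : ∫ x in Ioo (0 : ℝ) 1, η x = 1 := by
    rw [hη.integral_eq]
    exact B.integral_normed
  set c : ℝ := ∫ x in Ioo (0 : ℝ) 1, f x * η x with hc
  refine ⟨c, ?_⟩
  have key : ∀ φ, IsTest φ →
      ∫ x in Ioo (0 : ℝ) 1, f x * φ x = c * ∫ x in Ioo (0 : ℝ) 1, φ x := by
    intro φ hφ
    set I : ℝ := ∫ x in Ioo (0 : ℝ) 1, φ x with hI
    have hθ : IsTest (fun x => φ x - I * η x) := by
      refine ⟨hφ.1.sub (contDiff_const.mul hη.1), hφ.2.1.sub (hη.2.1.mul_left), ?_⟩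
      refine (tsupport_sub φ (fun x => I * η x)).trans (union_subset hφ.2.2 ?_)
      exact (tsupport_mul_subset_right (f := fun _ => I) (g := η)).trans hη.2.2
    obtain ⟨ψ, hψ, hd⟩ := hθ.exists_primitive (by
      rw [integral_sub hφ.integrable (hη.integrable.const_mul I), integral_const_mul, hηint]
      simp [hI])
    have h0 := h ψ hψ
    have hz : ∫ x in Ioo (0 : ℝ) 1, (0 : L2) x * ψ x = 0 := by
      simpa using integral_smul_mul 0 (0 : L2) ψ
    rw [hz, neg_zero, hd] at h0
    have e : ∀ x, f x * (φ x - I * η x) = f x * φ x - I * (f x * η x) := fun x => by ring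
    simp only [e] at h0
    rw [integral_sub (integrable_mul_of_memLp f hφ.memLp)
      ((integrable_mul_of_memLp f hη.memLp).const_mul I), integral_const_mul, ← hc] at h0
    linarith
  have hae : (fun x => f x - c) =ᵐ[unitMeasure] 0 := by
    refine eq_zero_of_integral_test ((L2.integrable f).sub (integrable_const c)) ?_
    intro φ hφ
    have e : ∀ x, (f x - c) * φ x = f x * φ x - c * φ x := fun x => by ring
    simp only [e]
    rw [integral_sub (integrable_mul_of_memLp f hφ.memLp) (hφ.integrable.const_mul c),
      integral_const_mul, key φ hφ, sub_self]
  filter_upwards [hae] with x hx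
  simpa [sub_eq_zero] using hx

/-- `H¹(0,1)`, as a set of elements of `L²(0,1)`: those with a weak derivative in `L²(0,1)`. -/
def H1Submodule : Submodule ℝ L2 where
  carrier := {f | ∃ g : L2, HasWeakDeriv f g}
  add_mem' := by
    rintro f₁ f₂ ⟨g₁, h₁⟩ ⟨g₂, h₂⟩
    exact ⟨g₁ + g₂, h₁.add h₂⟩
  zero_mem' := ⟨0, HasWeakDeriv.zero⟩
  smul_mem' := by
    rintro c f ⟨g, h⟩
    exact ⟨c • g, h.smul c⟩

/-- `H¹₍₁₎(0,1)`, as a set of elements of `L²(0,1)`: the `f ∈ H¹(0,1)` with `f(1) = 0`. The value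
at `1` is that of the continuous representative of `f` on `[0,1]`. -/
def H1RightSubmodule : Submodule ℝ L2 where
  carrier := {f | f ∈ H1Submodule ∧ ∃ F : ℝ → ℝ,
    ContinuousOn F (Icc 0 1) ∧ f =ᵐ[unitMeasure] F ∧ F 1 = 0}
  add_mem' := by
    rintro f₁ f₂ ⟨h₁, F₁, c₁, e₁, z₁⟩ ⟨h₂, F₂, c₂, e₂, z₂⟩
    refine ⟨H1Submodule.add_mem h₁ h₂, F₁ + F₂, c₁.add c₂, ?_, by simp [z₁, z₂]⟩
    exact (Lp.coeFn_add f₁ f₂).trans (e₁.add e₂)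
  zero_mem' := ⟨H1Submodule.zero_mem, 0, continuousOn_const, Lp.coeFn_zero _ _ _, rfl⟩
  smul_mem' := by
    rintro c f ⟨h, F, k, e, z⟩
    refine ⟨H1Submodule.smul_mem c h, c • F, k.const_smul c, ?_, by simp [z]⟩
    exact (Lp.coeFn_smul c f).trans (e.const_smul c)

/-- The weak derivative `f ↦ f'` from `H¹(0,1)` to `L²(0,1)`. -/
noncomputable def weakDeriv : H1Submodule →ₗ[ℝ] L2 where
  toFun f := f.2.choose
  map_add' f g :=
    (f + g).2.choose_spec.unique (f.2.choose_spec.add g.2.choose_spec)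
  map_smul' c f := (c • f).2.choose_spec.unique (f.2.choose_spec.smul c)

theorem hasWeakDeriv_weakDeriv (f : H1Submodule) : HasWeakDeriv (f : L2) (weakDeriv f) :=
  f.2.choose_spec

/-- The space `H¹(0,1)`, with its own norm (not that of `L²(0,1)`), given below. -/
def H1 : Type := H1Submodule

/-- The space `H¹₍₁₎(0,1)`, with its own norm (not that of `L²(0,1)`), given below. -/
def H1Right : Type := H1RightSubmodule

noncomputable instance : AddCommGroup H1 := inferInstanceAs (AddCommGroup H1Submodule)
noncomputable instance : Module ℝ H1 := inferInstanceAs (Module ℝ H1Submodule)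
noncomputable instance : AddCommGroup H1Right := inferInstanceAs (AddCommGroup H1RightSubmodule)
noncomputable instance : Module ℝ H1Right := inferInstanceAs (Module ℝ H1RightSubmodule)

/-- The underlying element of `L²(0,1)`. -/
noncomputable def H1.val : H1 →ₗ[ℝ] L2 := H1Submodule.subtype

/-- The weak derivative on `H¹(0,1)`. -/
noncomputable def H1.der : H1 →ₗ[ℝ] L2 := weakDeriv

/-- The underlying element of `L²(0,1)`. -/
noncomputable def H1Right.val : H1Right →ₗ[ℝ] L2 := H1RightSubmodule.subtype

/-- The weak derivative on `H¹₍₁₎(0,1)`. -/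
noncomputable def H1Right.der : H1Right →ₗ[ℝ] L2 :=
  weakDeriv.comp (Submodule.inclusion (fun _ hf => hf.1 : H1RightSubmodule ≤ H1Submodule))

theorem H1Right.eq_zero_of_der_eq_zero (f : H1Right) (h : H1Right.der f = 0) : f = 0 := by
  obtain ⟨hf, F, hF, hfF, hF1⟩ := f.2
  have hw : HasWeakDeriv (H1Right.val f) (H1Right.der f) := hasWeakDeriv_weakDeriv ⟨_, hf⟩
  rw [h] at hw
  obtain ⟨c, hc⟩ := hw.ae_const
  have hFc : F =ᵐ[unitMeasure] fun _ => c := hfF.symm.trans hc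
  have hIoo : EqOn F (fun _ => c) (Ioo 0 1) :=
    Measure.eqOn_open_of_ae_eq hFc isOpen_Ioo (hF.mono Ioo_subset_Icc_self) continuousOn_const
  have hIcc : EqOn F (fun _ => c) (Icc 0 1) :=
    hIoo.of_subset_closure hF continuousOn_const Ioo_subset_Icc_self
      (by rw [closure_Ioo zero_ne_one])
  have hc0 : c = 0 := by rw [← hF1]; exact (hIcc (right_mem_Icc.2 zero_le_one)).symm
  refine Subtype.ext ?_
  change H1Right.val f = 0
  rw [Lp.eq_zero_iff_ae_eq_zero]
  filter_upwards [hc] with x hx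
  rw [hx, hc0, Pi.zero_apply]

/-- The inner product `∫₀¹ (g₁ g₂ + g₁' g₂') dx` of `H¹(0,1)`. -/
@[reducible]
noncomputable def H1.innerCore : InnerProductSpace.Core ℝ H1 where
  inner g₁ g₂ := inner ℝ (H1.val g₁) (H1.val g₂) + inner ℝ (H1.der g₁) (H1.der g₂)
  conj_inner_symm f g := by simp [real_inner_comm]
  re_inner_nonneg f := add_nonneg real_inner_self_nonneg real_inner_self_nonneg
  add_left f g h := by simp only [map_add, inner_add_left]; ring
  smul_left f g r := by simp only [map_smul, real_inner_smul_left, conj_trivial]; ring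
  definite f hf := by
    have h1 : (0 : ℝ) ≤ inner ℝ (H1.val f) (H1.val f) := real_inner_self_nonneg
    have h2 : (0 : ℝ) ≤ inner ℝ (H1.der f) (H1.der f) := real_inner_self_nonneg
    have h3 : inner ℝ (H1.val f) (H1.val f) = (0 : ℝ) := by linarith
    exact Subtype.ext (inner_self_eq_zero.1 h3)

noncomputable instance : NormedAddCommGroup H1 := H1.innerCore.toNormedAddCommGroup
noncomputable instance : InnerProductSpace ℝ H1 := InnerProductSpace.ofCore H1.innerCore.toCore

/-- The inner product `∫₀¹ f₁' f₂' dx` of `H¹₍₁₎(0,1)`. -/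
@[reducible]
noncomputable def H1Right.innerCore : InnerProductSpace.Core ℝ H1Right where
  inner f₁ f₂ := inner ℝ (H1Right.der f₁) (H1Right.der f₂)
  conj_inner_symm f g := by simp [real_inner_comm]
  re_inner_nonneg f := real_inner_self_nonneg (x := H1Right.der f)
  add_left f g h := by simp only [map_add, inner_add_left]
  smul_left f g r := by simp only [map_smul, real_inner_smul_left, conj_trivial]
  definite f hf := H1Right.eq_zero_of_der_eq_zero f (inner_self_eq_zero.1 hf)

noncomputable instance : NormedAddCommGroup H1Right := H1Right.innerCore.toNormedAddCommGroup
noncomputable instance : InnerProductSpace ℝ H1Right :=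
  InnerProductSpace.ofCore H1Right.innerCore.toCore

/-- The Hilbert space `H¹₍₁₎(0,1) × H¹(0,1)`; `WithLp 2` selects the inner product that is the sum
of the inner products of the two factors. -/
abbrev HSpace : Type := WithLp 2 (H1Right × H1)

theorem HSpace.inner_eq (u v : HSpace) :
    inner ℝ u v = (∫ x in Ioo (0 : ℝ) 1, H1Right.der u.fst x * H1Right.der v.fst x) +
      ((∫ x in Ioo (0 : ℝ) 1, H1.val u.snd x * H1.val v.snd x) +
        ∫ x in Ioo (0 : ℝ) 1, H1.der u.snd x * H1.der v.snd x) := by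
  have key : ∀ f g : L2, inner ℝ f g = ∫ x in Ioo (0 : ℝ) 1, f x * g x := by
    intro f g
    rw [L2.inner_def]
    simp [mul_comm]
  rw [← key, ← key, ← key, WithLp.prod_inner_apply]
  rfl

/-- The element `u` of `H¹₍₁₎(0,1) × H¹(0,1)` is the (class of the) pair of functions `p`. -/
def HSpace.IsClassOf (u : HSpace) (p : (ℝ → ℝ) × (ℝ → ℝ)) : Prop :=
  H1Right.val u.fst =ᵐ[unitMeasure] p.1 ∧ H1.val u.snd =ᵐ[unitMeasure] p.2

/-- A Riesz basis of a Hilbert space: the image of a Hilbert (complete orthonormal) basis under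
a bounded linear operator with bounded inverse. -/
def IsRieszBasis {ι E : Type*} [NormedAddCommGroup E] [InnerProductSpace ℝ E] (v : ι → E) : Prop :=
  ∃ (e : HilbertBasis ι ℝ E) (T : E ≃L[ℝ] E), ∀ i, T (e i) = v i

/-! ### The two families of functions -/

section Families

open Real

/-- `Δ(a,b) = {(n,m) ∈ ℕ² : 4(b-a) = (4m² - (2n+1)²)π²}`. -/
def Delta (a b : ℝ) : Set (ℕ × ℕ) :=
  {p | 4 * (b - a) = (4 * (p.2 : ℝ) ^ 2 - (2 * (p.1 : ℝ) + 1) ^ 2) * π ^ 2}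

def Delta₁ (a b : ℝ) : Set ℕ := {n | ∃ m, (n, m) ∈ Delta a b}

def Delta₂ (a b : ℝ) : Set ℕ := {m | ∃ n, (n, m) ∈ Delta a b}

/-- The integer chosen below as `Exists.choose` is unique. -/
theorem Delta.left_unique {a b : ℝ} {n n' m : ℕ} (h : (n, m) ∈ Delta a b)
    (h' : (n', m) ∈ Delta a b) : n = n' := by
  simp only [Delta, mem_ofPred_eq] at h h'
  have h1 := mul_right_cancel₀ (pow_ne_zero 2 pi_ne_zero) (h.symm.trans h')
  have h2 : (2 * (n : ℝ) + 1) ^ 2 = (2 * (n' : ℝ) + 1) ^ 2 := by linarith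
  have h3 := (sq_eq_sq₀ (by positivity) (by positivity)).1 h2
  exact_mod_cast (show (n : ℝ) = n' by linarith)

/-- The integer chosen below as `Exists.choose` is unique. -/
theorem Delta.right_unique {a b : ℝ} {n m m' : ℕ} (h : (n, m) ∈ Delta a b)
    (h' : (n, m') ∈ Delta a b) : m = m' := by
  simp only [Delta, mem_ofPred_eq] at h h'
  have h1 := mul_right_cancel₀ (pow_ne_zero 2 pi_ne_zero) (h.symm.trans h')
  have h2 : (m : ℝ) ^ 2 = (m' : ℝ) ^ 2 := by linarith
  exact_mod_cast (sq_eq_sq₀ (by positivity) (by positivity)).1 h2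

noncomputable def lambda₁ (a : ℝ) (n : ℕ) : ℝ := a - ((n : ℝ) + 1 / 2) ^ 2 * π ^ 2

noncomputable def lambda₂ (b : ℝ) (m : ℕ) : ℝ := b - (m : ℝ) ^ 2 * π ^ 2

noncomputable def mu (m : ℕ) : ℝ := if m = 0 then 1 else √2

/-- `φ_{1,n} = (√2 cos((n+1/2)πx), 0)`. -/
noncomputable def phi₁ (n : ℕ) : (ℝ → ℝ) × (ℝ → ℝ) :=
  (fun x => √2 * cos (((n : ℝ) + 1 / 2) * π * x), fun _ => 0)

/-- The common second component of `φ_{2,m}` and `ψ_{2,m}`. -/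
noncomputable def cosMode (m : ℕ) : ℝ → ℝ :=
  fun x => if m = 0 then 1 else √2 * cos ((m : ℝ) * π * x)

open scoped Classical in
/-- The first component of `φ_{2,m}`. Here `r` stands for a complex square root of `λ_{2,m} - a`;
the expression whose real part is taken is then real. -/
noncomputable def phi₂Fst (a b s : ℝ) (r : ℂ) (m : ℕ) : ℝ → ℝ := fun x =>
  if h : m ∈ Delta₂ a b then
    s * mu m / (((h.choose : ℝ) + 1 / 2) * π) * (1 - x) * sin (((h.choose : ℝ) + 1 / 2) * π * x)
  else if b - a = (m : ℝ) ^ 2 * π ^ 2 then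
    s * mu m * (-1 + x)
  else
    (-((s * mu m : ℝ) : ℂ) / (r * Complex.cosh r) * Complex.sinh (r * (1 - (x : ℂ)))).re

noncomputable def phi₂ (a b s : ℝ) (r : ℂ) (m : ℕ) : (ℝ → ℝ) × (ℝ → ℝ) :=
  (phi₂Fst a b s r m, cosMode m)

open scoped Classical in
/-- The second component of `ψ_{1,n}`. Here `r` stands for a complex square root of `λ_{1,n} - b`;
the expression whose real part is taken is then real. -/
noncomputable def psi₁Snd (a b s : ℝ) (r : ℂ) (n : ℕ) : ℝ → ℝ := fun x =>
  if h : n ∈ Delta₁ a b then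
    if h.choose = 0 then
      -s * √2 * (1 / 3 + 1 / ((2 * (n : ℝ) + 1) ^ 2 * π ^ 2)) + √2 * s * x - √2 / 2 * s * x ^ 2
    else
      √2 * s / ((h.choose : ℝ) * π) * (1 - x) * sin ((h.choose : ℝ) * π * x) +
        -(2 * s / π ^ 2) * (1 / (2 * (n : ℝ) + 1) ^ 2 + 1 / (4 * (h.choose : ℝ) ^ 2)) *
          √2 * cos ((h.choose : ℝ) * π * x)
  else
    (-((√2 * s : ℝ) : ℂ) / (r * Complex.sinh r) * Complex.cosh (r * (1 - (x : ℂ)))).re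

noncomputable def psi₁ (a b s : ℝ) (r : ℂ) (n : ℕ) : (ℝ → ℝ) × (ℝ → ℝ) :=
  (fun x => √2 * cos (((n : ℝ) + 1 / 2) * π * x), psi₁Snd a b s r n)

/-- `ψ_{2,m} = (0, cosMode m)`. -/
noncomputable def psi₂ (m : ℕ) : (ℝ → ℝ) × (ℝ → ℝ) := (fun _ => 0, cosMode m)

theorem real_or_imaginary_of_sq {r : ℂ} {d : ℝ} (h : r ^ 2 = (d : ℂ)) :
    (∃ t : ℝ, r = t) ∨ ∃ t : ℝ, r = t * Complex.I := by
  have him := congrArg Complex.im h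
  simp only [sq, Complex.mul_im, Complex.ofReal_im] at him
  have : r.re = 0 ∨ r.im = 0 := by
    rcases mul_eq_zero.1 (show r.re * r.im = 0 by linarith) with h | h <;> simp [h]
  rcases this with h0 | h0
  · exact Or.inr ⟨r.im, by apply Complex.ext <;> simp [h0]⟩
  · exact Or.inl ⟨r.re, by apply Complex.ext <;> simp [h0]⟩

/-- Taking the real part in `phi₂Fst` changes nothing. -/
theorem phi₂Fst_real {r : ℂ} {d : ℝ} (h : r ^ 2 = (d : ℂ)) (c x : ℝ) :
    (-(c : ℂ) / (r * Complex.cosh r) * Complex.sinh (r * (1 - (x : ℂ)))).im = 0 := by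
  rcases real_or_imaginary_of_sq h with ⟨t, rfl⟩ | ⟨t, rfl⟩
  · have : -(c : ℂ) / ((t : ℂ) * Complex.cosh t) * Complex.sinh (t * (1 - (x : ℂ))) =
        ((-c / (t * Real.cosh t) * Real.sinh (t * (1 - x)) : ℝ) : ℂ) := by
      push_cast
      rfl
    rw [this, Complex.ofReal_im]
  · have e : (t : ℂ) * Complex.I * (1 - (x : ℂ)) = ((t * (1 - x) : ℝ) : ℂ) * Complex.I := by
      push_cast
      ring
    have : -(c : ℂ) / ((t : ℂ) * Complex.I * Real.cos t) *
        (Real.sin (t * (1 - x)) * Complex.I) =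
        ((-c / (t * Real.cos t) * Real.sin (t * (1 - x)) : ℝ) : ℂ) := by
      rw [mul_right_comm (t : ℂ), ← div_div, div_mul_eq_mul_div, mul_div_assoc,
        mul_div_cancel_right₀ _ Complex.I_ne_zero]
      push_cast
      rfl
    rw [e, Complex.cosh_mul_I, Complex.sinh_mul_I, ← Complex.ofReal_cos, ← Complex.ofReal_sin,
      this, Complex.ofReal_im]

/-- Taking the real part in `psi₁Snd` changes nothing. -/
theorem psi₁Snd_real {r : ℂ} {d : ℝ} (h : r ^ 2 = (d : ℂ)) (c x : ℝ) :
    (-(c : ℂ) / (r * Complex.sinh r) * Complex.cosh (r * (1 - (x : ℂ)))).im = 0 := by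
  rcases real_or_imaginary_of_sq h with ⟨t, rfl⟩ | ⟨t, rfl⟩
  · have : -(c : ℂ) / ((t : ℂ) * Complex.sinh t) * Complex.cosh (t * (1 - (x : ℂ))) =
        ((-c / (t * Real.sinh t) * Real.cosh (t * (1 - x)) : ℝ) : ℂ) := by
      push_cast
      rfl
    rw [this, Complex.ofReal_im]
  · have e : (t : ℂ) * Complex.I * (1 - (x : ℂ)) = ((t * (1 - x) : ℝ) : ℂ) * Complex.I := by
      push_cast
      ring
    have : -(c : ℂ) / ((t : ℂ) * Complex.I * (Real.sin t * Complex.I)) *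
        Real.cos (t * (1 - x)) =
        ((c / (t * Real.sin t) * Real.cos (t * (1 - x)) : ℝ) : ℂ) := by
      rw [mul_mul_mul_comm, Complex.I_mul_I, mul_neg_one, neg_div_neg_eq]
      push_cast
      rfl
    rw [e, Complex.cosh_mul_I, Complex.sinh_mul_I, ← Complex.ofReal_cos, ← Complex.ofReal_sin,
      this, Complex.ofReal_im]

/-- The rescaled family: `u n / ((n+1/2)π)` for the first half of the index set, and
`v m / √(1+m²π²)` for the second half. -/
noncomputable def rescaled (u v : ℕ → (ℝ → ℝ) × (ℝ → ℝ)) : ℕ ⊕ ℕ → (ℝ → ℝ) × (ℝ → ℝ)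
  | Sum.inl n => (1 / (((n : ℝ) + 1 / 2) * π)) • u n
  | Sum.inr m => (1 / √(1 + (m : ℝ) ^ 2 * π ^ 2)) • v m

end Families

end HeatCascade

/-!
The functions `√2 cos((n+1/2)πx)` and `μ_m cos(mπx)` are the eigenfunctions of `-d²/dx²` for the
mixed and the Neumann boundary conditions, so after normalisation they are Hilbert bases of
`H¹₍₁₎(0,1)` and `H¹(0,1)`; completeness reduces by duality to the density of trigonometric
polynomials in `L²(0,1)`. The rescaled `φ`-family is the image of the product of these two bases
under `(f, g) ↦ (f + Kg, g)`, and the rescaled `ψ`-family under `(f, g) ↦ (f, g + Kf)`; such a shear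
is boundedly invertible for every bounded `K`. Here `K` is even Hilbert–Schmidt: `Δ` is finite, and
for large index the square root `r` is `it` with `t` real and `|t|` within `1` of the frequency of
the corresponding cosine, which keeps `|cosh r|`, resp. `|sinh r|`, above `1/2` and the corrections
bounded in norm, while the normalisation factors are `O(1/n)`, hence square summable.
-/

namespace HeatCascade

open MeasureTheory Set Filter Real Topology Asymptotics
open scoped ContDiff InnerProductSpace ENNReal lp unitInterval

/-! ### Hilbert bases and synthesis operators -/

section HilbertBases

variable {ι κ 𝕜 E F : Type*} [RCLike 𝕜]
  [NormedAddCommGroup E] [InnerProductSpace 𝕜 E] [NormedAddCommGroup F]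

theorem lp_two_cauchySchwarz {A B : ι → Type*} [∀ i, NormedAddCommGroup (A i)]
    [∀ i, NormedAddCommGroup (B i)] (a : lp A 2) (b : lp B 2) :
    (Summable fun i => ‖a i‖ * ‖b i‖) ∧ ∑' i, ‖a i‖ * ‖b i‖ ≤ ‖a‖ * ‖b‖ := by
  have h2 : 0 < (2 : ℝ≥0∞).toReal := by norm_num
  rw [lp.norm_eq_tsum_rpow h2 a, lp.norm_eq_tsum_rpow h2 b]
  exact Real.summable_and_inner_le_Lp_mul_Lq_tsum_of_nonneg
    (by simpa only [ENNReal.toReal_ofNat] using Real.HolderConjugate.two_two)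
    (fun i => norm_nonneg (a i)) (fun i => norm_nonneg (b i))
    ((lp.memℓp a).summable h2) ((lp.memℓp b).summable h2)

/-- The synthesis operator of a square-summable family `w`: the bounded operator that sends each
vector `e i` of a Hilbert basis to `w i`. -/
noncomputable def synthesis [NormedSpace 𝕜 F] [CompleteSpace F] (e : HilbertBasis ι 𝕜 E)
    (w : lp (fun _ : ι => F) 2) : E →L[𝕜] F :=
  have hsum (x : E) : Summable fun i => e.repr x i • w i :=
    .of_norm <| by simpa only [norm_smul] using (lp_two_cauchySchwarz (e.repr x) w).1
  LinearMap.mkContinuous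
    { toFun x := ∑' i, e.repr x i • w i
      map_add' x y := by
        simp only [map_add, lp.coeFn_add, Pi.add_apply, add_smul, (hsum x).tsum_add (hsum y)]
      map_smul' c x := by
        simp only [map_smul, lp.coeFn_smul, Pi.smul_apply, smul_assoc, RingHom.id_apply,
          (hsum x).tsum_const_smul c] }
    ‖w‖ fun x =>
      calc ‖∑' i, e.repr x i • w i‖ ≤ ∑' i, ‖e.repr x i‖ * ‖w i‖ :=
            tsum_of_norm_bounded (lp_two_cauchySchwarz (e.repr x) w).1.hasSum
              fun i => (norm_smul _ _).le
        _ ≤ ‖e.repr x‖ * ‖w‖ := (lp_two_cauchySchwarz (e.repr x) w).2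
        _ = ‖w‖ * ‖x‖ := by rw [e.repr.norm_map, mul_comm]

theorem synthesis_apply_self [NormedSpace 𝕜 F] [CompleteSpace F] (e : HilbertBasis ι 𝕜 E)
    (w : lp (fun _ : ι => F) 2) (i : ι) : synthesis e w (e i) = w i := by
  classical
  change ∑' j, e.repr (e i) j • w j = w i
  rw [tsum_eq_single i fun j hj => by
    rw [e.repr_self, lp.single_apply_ne _ _ _ hj, zero_smul], e.repr_self, lp.single_apply_self,
    one_smul]

theorem mem_orthogonal_span_range {v : ι → E} {x : E} :
    x ∈ (Submodule.span 𝕜 (range v))ᗮ ↔ ∀ i, inner 𝕜 (v i) x = 0 := by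
  rw [← Submodule.span_singleton_le_iff_mem, ← Submodule.isOrtho_iff_le, Submodule.isOrtho_comm,
    Submodule.isOrtho_span]
  simp

theorem eq_zero_of_forall_inner_basis_eq_zero (e : HilbertBasis ι 𝕜 E) {x : E}
    (h : ∀ i, inner 𝕜 (e i) x = 0) : x = 0 :=
  e.repr.injective <| by ext i; simp [e.repr_apply_apply, h]

variable [InnerProductSpace 𝕜 F] [CompleteSpace E] [CompleteSpace F]

/-- The Hilbert basis of an orthogonal direct sum formed by Hilbert bases of its summands. -/
noncomputable def prodHilbertBasis (e : HilbertBasis ι 𝕜 E) (f : HilbertBasis κ 𝕜 F) :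
    HilbertBasis (ι ⊕ κ) 𝕜 (WithLp 2 (E × F)) :=
  HilbertBasis.mkOfOrthogonalEqBot
    (v := Sum.elim (fun i => WithLp.toLp 2 (e i, 0)) fun k => WithLp.toLp 2 (0, f k))
    (by
      classical
      rw [orthonormal_iff_ite]
      rintro (i | k) (j | l) <;>
        simp [WithLp.prod_inner_apply, orthonormal_iff_ite.1 e.orthonormal,
          orthonormal_iff_ite.1 f.orthonormal])
    ((Submodule.eq_bot_iff _).2 fun x hx => by
      rw [mem_orthogonal_span_range] at hx
      have hfst : x.fst = 0 := eq_zero_of_forall_inner_basis_eq_zero e fun i => by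
        simpa [WithLp.prod_inner_apply] using hx (Sum.inl i)
      have hsnd : x.snd = 0 := eq_zero_of_forall_inner_basis_eq_zero f fun k => by
        simpa [WithLp.prod_inner_apply] using hx (Sum.inr k)
      exact WithLp.ofLp_injective 2 (Prod.ext hfst hsnd))

theorem coe_prodHilbertBasis (e : HilbertBasis ι 𝕜 E) (f : HilbertBasis κ 𝕜 F) :
    ⇑(prodHilbertBasis e f) =
      Sum.elim (fun i => WithLp.toLp 2 (e i, 0)) fun k => WithLp.toLp 2 (0, f k) :=
  HilbertBasis.coe_mkOfOrthogonalEqBot _ _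

end HilbertBases

/-! ### Riesz bases of a product -/

section RieszBases

variable {ι κ E F : Type*} [NormedAddCommGroup E] [InnerProductSpace ℝ E] [CompleteSpace E]
  [NormedAddCommGroup F] [InnerProductSpace ℝ F] [CompleteSpace F]

/-- Perturbing a product basis by a square-summable family in the second factor amounts to applying
the invertible operator `(x, y) ↦ (x, y + K x)`, where `K` is the synthesis operator of the
perturbation. -/
theorem isRieszBasis_sum_lower (e : HilbertBasis ι ℝ E) (f : HilbertBasis κ ℝ F)
    (w : lp (fun _ : ι => F) 2) :
    IsRieszBasis (Sum.elim (fun i => WithLp.toLp 2 (e i, w i))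
      fun k => (WithLp.toLp 2 (0, f k) : WithLp 2 (E × F))) := by
  let toProd := WithLp.prodContinuousLinearEquiv 2 ℝ E F
  let shear := (ContinuousLinearEquiv.refl ℝ E).skewProd (.refl ℝ F) (synthesis e w)
  refine ⟨prodHilbertBasis e f, (toProd.trans shear).trans toProd.symm, ?_⟩
  rintro (i | k) <;> refine congrArg (WithLp.toLp 2) ?_ <;>
    simp [toProd, shear, coe_prodHilbertBasis, synthesis_apply_self]

theorem isRieszBasis_sum_upper (e : HilbertBasis ι ℝ E) (f : HilbertBasis κ ℝ F)
    (w : lp (fun _ : κ => E) 2) :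
    IsRieszBasis (Sum.elim (fun i => WithLp.toLp 2 (e i, 0))
      fun k => (WithLp.toLp 2 (w k, f k) : WithLp 2 (E × F))) := by
  let toProd := (WithLp.prodContinuousLinearEquiv 2 ℝ E F).trans (.prodComm ℝ E F)
  let shear := (ContinuousLinearEquiv.refl ℝ F).skewProd (.refl ℝ E) (synthesis f w)
  refine ⟨prodHilbertBasis e f, (toProd.trans shear).trans toProd.symm, ?_⟩
  rintro (i | k) <;> refine congrArg (WithLp.toLp 2) ?_ <;>
    simp [toProd, shear, coe_prodHilbertBasis, synthesis_apply_self]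

end RieszBases

section NormalizedHilbertBasis

variable {ι E : Type*} [NormedAddCommGroup E] [InnerProductSpace ℝ E] [DecidableEq ι]
  {v : ι → E} {c κ : ι → ℝ}

theorem orthonormal_smul (hv : ∀ i j, inner ℝ (v i) (v j) = if i = j then κ i else 0)
    (hc : ∀ i, c i ^ 2 * κ i = 1) : Orthonormal ℝ fun i => c i • v i := by
  refine orthonormal_iff_ite.2 fun i j => ?_
  rw [real_inner_smul_left, real_inner_smul_right, hv]
  split_ifs with h
  · rw [← h, ← mul_assoc, ← sq, hc]
  · simp

variable [CompleteSpace E] (hv : ∀ i j, inner ℝ (v i) (v j) = if i = j then κ i else 0)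
  (hc : ∀ i, c i ^ 2 * κ i = 1) (htotal : ∀ x, (∀ i, inner ℝ (v i) x = 0) → x = 0)

/-- The Hilbert basis obtained by rescaling a total orthogonal family `v` with
`‖v i‖² = κ i = 1 / c i²`. -/
noncomputable def normalizedHilbertBasis : HilbertBasis ι ℝ E :=
  .mkOfOrthogonalEqBot (orthonormal_smul hv hc) <| (Submodule.eq_bot_iff _).2 fun x hx =>
    htotal x fun i => by
      have hci : c i ≠ 0 := fun h => by simpa [h] using hc i
      simpa [real_inner_smul_left, hci] using mem_orthogonal_span_range.1 hx i

theorem normalizedHilbertBasis_apply (i : ι) :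
    normalizedHilbertBasis hv hc htotal i = c i • v i := by
  simp [normalizedHilbertBasis]

end NormalizedHilbertBasis

theorem memlp_smul_of_isBigO {E : Type*} [NormedAddCommGroup E] [NormedSpace ℝ E] {k : ℕ → ℝ}
    {v : ℕ → E} (hk : k =O[atTop] fun n => (n : ℝ)⁻¹) (hv : v =O[atTop] fun _ => (1 : ℝ)) :
    Memℓp (fun n => k n • v n) 2 := by
  refine memℓp_gen (summable_of_isBigO_nat (g := fun n : ℕ => ((n : ℝ) ^ 2)⁻¹)
    (Real.summable_nat_pow_inv.2 one_lt_two) ?_)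
  simpa [inv_pow] using (hk.smul hv).norm_left.pow 2

/-! ### Completeness of the cosines -/

/-- The cosine `cos (kπx)` as a continuous function on `[0,1]`. Negative frequencies are allowed so
that the product formula needs no case distinction. -/
noncomputable def cosine (k : ℤ) : C(I, ℝ) where
  toFun x := cos (k * π * x)

theorem cosine_zero : cosine 0 = 1 := by ext x; simp [cosine]

theorem cosine_natAbs (k : ℤ) : cosine k.natAbs = cosine k := by
  ext x
  rcases abs_choice k with h | h <;> simp [cosine, h]

theorem cosine_mul_cosine (j k : ℤ) :
    cosine j * cosine k = (1 / 2 : ℝ) • (cosine (j - k) + cosine (j + k)) := by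
  ext x
  simp only [cosine, ContinuousMap.mul_apply, ContinuousMap.coe_mk, ContinuousMap.smul_apply,
    ContinuousMap.add_apply, smul_eq_mul, Int.cast_sub, Int.cast_add, sub_mul, add_mul]
  rw [← two_mul_cos_mul_cos]
  ring

/-- The algebra of trigonometric polynomials in the functions `cos (kπx)` on `[0,1]`. -/
noncomputable def cosineSubalgebra : Subalgebra ℝ C(I, ℝ) :=
  (Submodule.span ℝ (range cosine)).toSubalgebra
    (Submodule.subset_span ⟨0, cosine_zero⟩) fun f g hf hg => by
      have hmul := Submodule.mul_mem_mul hf hg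
      rw [Submodule.span_mul_span] at hmul
      refine Submodule.span_le.2 ?_ hmul
      rintro _ ⟨_, ⟨j, rfl⟩, _, ⟨k, rfl⟩, rfl⟩
      beta_reduce
      rw [cosine_mul_cosine]
      exact Submodule.smul_mem _ _ (Submodule.add_mem _ (Submodule.subset_span ⟨_, rfl⟩)
        (Submodule.subset_span ⟨_, rfl⟩))

theorem cosineSubalgebra_separatesPoints : cosineSubalgebra.SeparatesPoints := by
  intro x y hxy
  refine ⟨cosine 1, ⟨cosine 1, Submodule.subset_span ⟨1, rfl⟩, rfl⟩, fun h => hxy ?_⟩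
  have hmem (z : I) : π * z ∈ Icc 0 π :=
    ⟨mul_nonneg pi_pos.le z.2.1, mul_le_of_le_one_right pi_pos.le z.2.2⟩
  simp only [cosine, ContinuousMap.coe_mk, Int.cast_one, one_mul] at h
  exact Subtype.ext (mul_left_cancel₀ pi_ne_zero (injOn_cos (hmem x) (hmem y) h))

theorem span_cosine_topologicalClosure :
    (Submodule.span ℝ (range cosine)).topologicalClosure = ⊤ :=
  congrArg Subalgebra.toSubmodule <|
    ContinuousMap.subalgebra_topologicalClosure_eq_top_of_separatesPoints cosineSubalgebra
      cosineSubalgebra_separatesPoints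

theorem map_coe_unitInterval : (volume : Measure I).map (↑) = unitMeasure := by
  rw [volume_set_coe_def, map_comap_subtype_coe measurableSet_Icc]
  exact Measure.restrict_congr_set Ioo_ae_eq_Icc.symm

theorem span_toLp_cosine_topologicalClosure :
    (Submodule.span ℝ (range fun k => ContinuousMap.toLp (E := ℝ) 2 (volume : Measure I) ℝ
      (cosine k))).topologicalClosure = ⊤ := by
  have hdense := (ContinuousMap.toLp_denseRange ℝ (volume : Measure I) ℝ
    (p := 2) ENNReal.ofNat_ne_top).topologicalClosure_map_submodule span_cosine_topologicalClosure
  rw [Submodule.map_span] at hdense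
  rwa [range_comp']

theorem ae_eq_zero_of_integral_cos {u : ℝ → ℝ} (hu : MemLp u 2 unitMeasure)
    (h : ∀ k : ℕ, ∫ x in Ioo (0 : ℝ) 1, u x * cos (k * π * x) = 0) : u =ᵐ[unitMeasure] 0 := by
  have hcoe : MeasurableEmbedding ((↑) : I → ℝ) := .subtype_coe measurableSet_Icc
  have huI : MemLp (fun x : I => u x) 2 := by
    rwa [← map_coe_unitInterval, hcoe.memLp_map_measure_iff] at hu
  have hinner (k : ℤ) : inner ℝ (ContinuousMap.toLp 2 volume ℝ (cosine k)) (huI.toLp _) = 0 := by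
    have hk : ∫ x : I, u x * cos (k.natAbs * π * x) = 0 := by
      rw [← hcoe.integral_map (g := fun x => u x * cos (k.natAbs * π * x)), map_coe_unitInterval,
        h]
    rw [← cosine_natAbs, L2.inner_def]
    refine (integral_congr_ae ?_).trans hk
    filter_upwards [ContinuousMap.coeFn_toLp (p := 2) (𝕜 := ℝ) (volume : Measure I)
      (cosine k.natAbs), huI.coeFn_toLp] with x hcos hux
    rw [hcos, hux]
    simp [cosine]
  have hzero : huI.toLp _ = 0 :=
    (Submodule.dense_iff_topologicalClosure_eq_top.2
      span_toLp_cosine_topologicalClosure).eq_zero_of_mem_orthogonal <|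
        mem_orthogonal_span_range.2 hinner
  rw [← map_coe_unitInterval, EventuallyEq, hcoe.ae_map_iff]
  exact (MemLp.toLp_eq_toLp_iff huI MemLp.zero).1 hzero

theorem ae_eq_zero_of_integral_cos_add_half {u : ℝ → ℝ} (hu : MemLp u 2 unitMeasure)
    (h : ∀ n : ℕ, ∫ x in Ioo (0 : ℝ) 1, u x * cos ((n + 1 / 2) * π * x) = 0) :
    u =ᵐ[unitMeasure] 0 := by
  have hint (n : ℕ) : Integrable (fun x => u x * cos ((n + 1 / 2) * π * x)) unitMeasure :=
    (hu.integrable one_le_two).mul_bdd (c := 1)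
      (by fun_prop) (.of_forall fun x => abs_cos_le_one _)
  -- The positive factor `cos (πx/2)` turns half-integer frequencies into integer ones.
  have hmem : MemLp (fun x => u x * cos (π / 2 * x)) 2 unitMeasure :=
    MemLp.mul' (q := ∞) (.of_bound (by fun_prop) 1 (.of_forall fun x => abs_cos_le_one _)) hu
  have hprod : (fun x => u x * cos (π / 2 * x)) =ᵐ[unitMeasure] 0 := by
    refine ae_eq_zero_of_integral_cos hmem fun k => ?_
    rcases k with - | k
    · simpa [div_eq_inv_mul, mul_comm π] using h 0
    have hsplit (x : ℝ) : u x * cos (π / 2 * x) * cos ((k + 1 : ℕ) * π * x) =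
        1 / 2 * (u x * cos ((k + 1 / 2) * π * x) +
          u x * cos (((k + 1 : ℕ) + 1 / 2) * π * x)) := by
      have hcos := two_mul_cos_mul_cos ((k + 1 : ℕ) * π * x) (π / 2 * x)
      rw [show (k + 1 : ℕ) * π * x - π / 2 * x = (k + 1 / 2) * π * x by push_cast; ring,
        show (k + 1 : ℕ) * π * x + π / 2 * x = ((k + 1 : ℕ) + 1 / 2) * π * x by ring] at hcos
      linear_combination u x / 2 * hcos
    simp only [hsplit]
    rw [integral_const_mul, integral_add (hint k) (hint (k + 1)), h, h, add_zero, mul_zero]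
  filter_upwards [hprod, ae_restrict_mem measurableSet_Ioo] with x hx hx01
  refine (mul_eq_zero.1 hx).resolve_right (cos_pos_of_mem_Ioo ⟨?_, ?_⟩).ne' <;>
    nlinarith [pi_pos, hx01.1, hx01.2]

/-! ### Weak derivatives and integration by parts -/

theorem memLp_unitMeasure_of_continuousOn {F : ℝ → ℝ} (hF : ContinuousOn F (Icc 0 1)) :
    MemLp F 2 unitMeasure := by
  obtain ⟨C, hC⟩ := isCompact_Icc.exists_bound_of_continuousOn hF
  exact .of_bound ((hF.mono Ioo_subset_Icc_self).aestronglyMeasurable measurableSet_Ioo) C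
    (ae_restrict_of_forall_mem measurableSet_Ioo fun x hx => hC x (Ioo_subset_Icc_self hx))

theorem integral_unitMeasure_eq_intervalIntegral (F : ℝ → ℝ) :
    ∫ x in Ioo (0 : ℝ) 1, F x = ∫ x in (0 : ℝ)..1, F x := by
  rw [intervalIntegral.integral_of_le zero_le_one, integral_Ioc_eq_integral_Ioo]

theorem L2.inner_eq_integral (f g : L2) :
    inner ℝ f g = ∫ x in Ioo (0 : ℝ) 1, f x * g x := by
  simp [L2.inner_def, mul_comm]

theorem L2.intervalIntegrable (h : L2) : IntervalIntegrable h volume 0 1 :=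
  (intervalIntegrable_iff_integrableOn_Ioo_of_le zero_le_one).2 (L2.integrable h)

theorem integral_mul_deriv_of_absolutelyContinuous {F φ : ℝ → ℝ}
    (hF : AbsolutelyContinuousOnInterval F 0 1) (hφ : AbsolutelyContinuousOnInterval φ 0 1)
    (hboundary : F 1 * φ 1 = F 0 * φ 0) :
    ∫ x in Ioo (0 : ℝ) 1, F x * deriv φ x = -∫ x in Ioo (0 : ℝ) 1, deriv F x * φ x := by
  rw [integral_unitMeasure_eq_intervalIntegral, integral_unitMeasure_eq_intervalIntegral,
    hF.integral_mul_deriv_eq_deriv_mul hφ, hboundary, sub_self, zero_sub]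

theorem IsTest.absolutelyContinuousOnInterval {φ : ℝ → ℝ} (hφ : IsTest φ) :
    AbsolutelyContinuousOnInterval φ 0 1 :=
  (hφ.1.of_le (by simp)).contDiffOn.absolutelyContinuousOnInterval

theorem IsTest.apply_zero {φ : ℝ → ℝ} (hφ : IsTest φ) : φ 0 = 0 :=
  image_eq_zero_of_notMem_tsupport fun h => (hφ.2.2 h).1.false

theorem IsTest.apply_one {φ : ℝ → ℝ} (hφ : IsTest φ) : φ 1 = 0 :=
  image_eq_zero_of_notMem_tsupport fun h => (hφ.2.2 h).2.false

/-- The class in `L²(0,1)` of a function that is continuous on `[0,1]`. -/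
noncomputable def toL2 {F : ℝ → ℝ} (hF : ContinuousOn F (Icc 0 1)) : L2 :=
  (memLp_unitMeasure_of_continuousOn hF).toLp F

theorem coeFn_toL2 {F : ℝ → ℝ} (hF : ContinuousOn F (Icc 0 1)) : toL2 hF =ᵐ[unitMeasure] F :=
  (memLp_unitMeasure_of_continuousOn hF).coeFn_toLp

theorem integral_congr_mul_ae {f g : ℝ → ℝ} (h : f =ᵐ[unitMeasure] g) (φ : ℝ → ℝ) :
    ∫ x in Ioo (0 : ℝ) 1, f x * φ x = ∫ x in Ioo (0 : ℝ) 1, g x * φ x :=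
  integral_congr_ae (h.mul .rfl)

theorem norm_toL2_le {F : ℝ → ℝ} (hF : ContinuousOn F (Icc 0 1)) {C : ℝ}
    (hC : ∀ x ∈ Icc (0 : ℝ) 1, |F x| ≤ C) : ‖toL2 hF‖ ≤ C := by
  have hC0 : 0 ≤ C := (abs_nonneg _).trans (hC 0 (left_mem_Icc.2 zero_le_one))
  have hbound : ∀ᵐ x ∂unitMeasure, ‖toL2 hF x‖ ≤ C := by
    filter_upwards [coeFn_toL2 hF, ae_restrict_mem measurableSet_Ioo] with x hx hx01
    rw [hx]
    exact hC x (Ioo_subset_Icc_self hx01)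
  simpa [measureUnivNNReal] using Lp.norm_le_of_ae_bound hC0 hbound

theorem hasWeakDeriv_toL2 {F : ℝ → ℝ} (hF : ContDiff ℝ 1 F) :
    HasWeakDeriv (toL2 hF.continuous.continuousOn)
      (toL2 (hF.continuous_deriv le_rfl).continuousOn) := by
  intro φ hφ
  rw [integral_congr_mul_ae (coeFn_toL2 _), integral_congr_mul_ae (coeFn_toL2 _)]
  exact integral_mul_deriv_of_absolutelyContinuous
    hF.contDiffOn.absolutelyContinuousOnInterval hφ.absolutelyContinuousOnInterval
    (by rw [hφ.apply_zero, hφ.apply_one, mul_zero, mul_zero])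

/-- The primitive of `h ∈ L²(0,1)` that vanishes at `1`: the continuous representative of the
element of `H¹₍₁₎(0,1)` with weak derivative `h`. -/
noncomputable def L2.primitive (h : L2) (x : ℝ) : ℝ := ∫ t in (1 : ℝ)..x, h t

theorem L2.primitive_one (h : L2) : h.primitive 1 = 0 := intervalIntegral.integral_same

theorem L2.absolutelyContinuousOnInterval_primitive (h : L2) :
    AbsolutelyContinuousOnInterval h.primitive 0 1 :=
  h.intervalIntegrable.absolutelyContinuousOnInterval_intervalIntegral right_mem_uIcc

theorem L2.continuousOn_primitive (h : L2) : ContinuousOn h.primitive (Icc 0 1) := by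
  rw [← uIcc_of_le zero_le_one]
  exact h.absolutelyContinuousOnInterval_primitive.continuousOn

theorem L2.deriv_primitive_ae_eq (h : L2) : deriv h.primitive =ᵐ[unitMeasure] h := by
  refine (ae_restrict_iff' measurableSet_Ioo).2 ?_
  filter_upwards [h.intervalIntegrable.ae_hasDerivAt_integral] with x hx hx01
  rw [uIcc_of_le zero_le_one] at hx
  exact (hx (Ioo_subset_Icc_self hx01) 1 (right_mem_Icc.2 zero_le_one)).deriv

theorem L2.integral_primitive_mul_deriv (h : L2) {φ : ℝ → ℝ}
    (hφ : AbsolutelyContinuousOnInterval φ 0 1) (hφ0 : φ 0 = 0) :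
    ∫ x in Ioo (0 : ℝ) 1, h.primitive x * deriv φ x = -∫ x in Ioo (0 : ℝ) 1, h x * φ x := by
  rw [← integral_congr_mul_ae h.deriv_primitive_ae_eq]
  exact integral_mul_deriv_of_absolutelyContinuous h.absolutelyContinuousOnInterval_primitive hφ
    (by rw [h.primitive_one, hφ0, zero_mul, mul_zero])

theorem L2.hasWeakDeriv_primitive (h : L2) : HasWeakDeriv (toL2 h.continuousOn_primitive) h := by
  intro φ hφ
  rw [integral_congr_mul_ae (coeFn_toL2 _)]
  exact h.integral_primitive_mul_deriv hφ.absolutelyContinuousOnInterval hφ.apply_zero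

theorem isClosed_setOf_hasWeakDeriv : IsClosed {p : L2 × L2 | HasWeakDeriv p.1 p.2} := by
  simp only [HasWeakDeriv, ofPred_forall]
  refine isClosed_iInter fun φ => isClosed_iInter fun hφ => ?_
  have hcont {ψ : ℝ → ℝ} (hψ : MemLp ψ 2 unitMeasure) :
      Continuous fun f : L2 => ∫ x in Ioo (0 : ℝ) 1, f x * ψ x := by
    refine (continuous_id.inner (continuous_const (y := hψ.toLp ψ))).congr fun f => ?_
    rw [L2.inner_eq_integral]
    exact integral_congr_ae (.mul .rfl hψ.coeFn_toLp)
  exact isClosed_eq ((hcont hφ.memLp_deriv).comp continuous_fst)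
    ((hcont hφ.memLp).comp continuous_snd).neg

/-! ### The space `H¹(0,1)` -/

namespace H1

theorem hasWeakDeriv (u : H1) : HasWeakDeriv (H1.val u) (H1.der u) :=
  hasWeakDeriv_weakDeriv u

theorem inner_eq (u v : H1) :
    inner ℝ u v = inner ℝ (H1.val u) (H1.val v) + inner ℝ (H1.der u) (H1.der v) := rfl

/-- The isometric embedding `u ↦ (u, u')` of `H¹(0,1)` into `L²(0,1) × L²(0,1)`. -/
noncomputable def valDer : H1 →ₗᵢ[ℝ] WithLp 2 (L2 × L2) :=
  ((WithLp.linearEquiv 2 ℝ (L2 × L2)).symm.toLinearMap ∘ₗ H1.val.prod H1.der).isometryOfInner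
    fun _ _ => WithLp.prod_inner_apply _ _

theorem range_valDer : range valDer = {p | HasWeakDeriv p.fst p.snd} := by
  ext p
  refine ⟨?_, fun hp => ⟨⟨p.fst, p.snd, hp⟩, ?_⟩⟩
  · rintro ⟨u, rfl⟩
    exact u.hasWeakDeriv
  · exact WithLp.ofLp_injective 2 (Prod.ext rfl ((H1.hasWeakDeriv _).unique hp))

instance : CompleteSpace H1 := by
  rw [completeSpace_iff_isComplete_range valDer.isometry.isUniformInducing, range_valDer]
  exact (isClosed_setOf_hasWeakDeriv.preimage
    (WithLp.prod_continuous_ofLp 2 L2 L2)).isComplete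

theorem norm_le_add (u : H1) : ‖u‖ ≤ ‖H1.val u‖ + ‖H1.der u‖ := by
  rw [← valDer.norm_map, WithLp.prod_norm_eq_of_L2]
  exact sqrt_le_iff.2 ⟨by positivity,
    (by nlinarith [mul_nonneg (norm_nonneg (H1.val u)) (norm_nonneg (H1.der u))] :
      ‖H1.val u‖ ^ 2 + ‖H1.der u‖ ^ 2 ≤ (‖H1.val u‖ + ‖H1.der u‖) ^ 2)⟩

theorem exists_val_ae_eq_add_primitive (u : H1) :
    ∃ c : ℝ, H1.val u =ᵐ[unitMeasure] fun x => c + (H1.der u).primitive x := by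
  have hdiff : HasWeakDeriv (H1.val u + (-1 : ℝ) • toL2 (H1.der u).continuousOn_primitive) 0 := by
    simpa using u.hasWeakDeriv.add ((H1.der u).hasWeakDeriv_primitive.smul (-1))
  obtain ⟨c, hc⟩ := hdiff.ae_const
  refine ⟨c, ?_⟩
  filter_upwards [hc, Lp.coeFn_add (H1.val u) ((-1 : ℝ) • toL2 (H1.der u).continuousOn_primitive),
    Lp.coeFn_smul (-1 : ℝ) (toL2 (H1.der u).continuousOn_primitive),
    coeFn_toL2 (H1.der u).continuousOn_primitive] with x hconst hadd hsmul hprim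
  rw [hadd, Pi.add_apply, hsmul, Pi.smul_apply, hprim, smul_eq_mul] at hconst
  linarith

theorem integral_val_mul_deriv (u : H1) {φ : ℝ → ℝ} (hφ : ContDiff ℝ 1 φ) (hφ0 : φ 0 = 0)
    (hφ1 : φ 1 = 0) :
    ∫ x in Ioo (0 : ℝ) 1, H1.val u x * deriv φ x = -∫ x in Ioo (0 : ℝ) 1, H1.der u x * φ x := by
  obtain ⟨c, hc⟩ := u.exists_val_ae_eq_add_primitive
  have hφac := hφ.contDiffOn.absolutelyContinuousOnInterval (a := 0) (b := 1)
  have hφ' := memLp_unitMeasure_of_continuousOn (hφ.continuous_deriv le_rfl).continuousOn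
  have hprim : Integrable (fun x => (H1.der u).primitive x * deriv φ x) unitMeasure :=
    (memLp_unitMeasure_of_continuousOn (H1.der u).continuousOn_primitive).integrable_mul hφ'
  have hderiv : ∫ x in Ioo (0 : ℝ) 1, deriv φ x = 0 := by
    rw [integral_unitMeasure_eq_intervalIntegral, hφac.integral_deriv_eq_sub, hφ0, hφ1, sub_zero]
  rw [← (H1.der u).integral_primitive_mul_deriv hφac hφ0, integral_congr_mul_ae hc]
  simp only [add_mul]
  rw [integral_add ((hφ'.integrable one_le_two).const_mul c) hprim,
    integral_const_mul, hderiv, mul_zero, zero_add]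

/-- The class in `H¹(0,1)` of a `C¹` function. -/
noncomputable def ofContDiff {F : ℝ → ℝ} (hF : ContDiff ℝ 1 F) : H1 :=
  ⟨toL2 hF.continuous.continuousOn, _, hasWeakDeriv_toL2 hF⟩

variable {F : ℝ → ℝ} (hF : ContDiff ℝ 1 F)

theorem val_ofContDiff_ae_eq : H1.val (ofContDiff hF) =ᵐ[unitMeasure] F :=
  coeFn_toL2 hF.continuous.continuousOn

theorem der_ofContDiff :
    H1.der (ofContDiff hF) = toL2 (hF.continuous_deriv le_rfl).continuousOn :=
  (H1.hasWeakDeriv _).unique (hasWeakDeriv_toL2 hF)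

theorem norm_ofContDiff_le {C C' : ℝ} (hC : ∀ x ∈ Icc (0 : ℝ) 1, |F x| ≤ C)
    (hC' : ∀ x ∈ Icc (0 : ℝ) 1, |deriv F x| ≤ C') : ‖ofContDiff hF‖ ≤ C + C' := by
  refine (norm_le_add _).trans (add_le_add ?_ ?_)
  · exact norm_toL2_le hF.continuous.continuousOn hC
  · rw [der_ofContDiff]
    exact norm_toL2_le _ hC'

end H1

/-- Weak form of the Neumann eigenvalue problem `-F'' = κF`, `F'(0) = F'(1) = 0`. -/
theorem H1.inner_ofContDiff_of_deriv_deriv_eq {F : ℝ → ℝ} (hF : ContDiff ℝ 2 F) {κ : ℝ}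
    (hκ : ∀ x, deriv (deriv F) x = -κ * F x) (h0 : deriv F 0 = 0) (h1 : deriv F 1 = 0) (u : H1) :
    inner ℝ (H1.ofContDiff (hF.of_le one_le_two)) u =
      (1 + κ) * ∫ x in Ioo (0 : ℝ) 1, H1.val u x * F x := by
  have hF' : ContDiff ℝ 1 (deriv F) := (contDiff_succ_iff_deriv.1 hF).2.2
  have hparts := u.integral_val_mul_deriv hF' h0 h1
  simp only [hκ, mul_left_comm _ (-κ), integral_const_mul] at hparts
  rw [H1.inner_eq, H1.der_ofContDiff, L2.inner_eq_integral, L2.inner_eq_integral,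
    integral_congr_mul_ae (H1.val_ofContDiff_ae_eq _), integral_congr_mul_ae (coeFn_toL2 _)]
  simp only [mul_comm (F _), mul_comm (deriv F _)]
  linarith

namespace H1Right

theorem hasWeakDeriv (f : H1Right) : HasWeakDeriv (H1Right.val f) (H1Right.der f) :=
  hasWeakDeriv_weakDeriv ⟨_, f.2.1⟩

theorem inner_eq (f g : H1Right) : inner ℝ f g = inner ℝ (H1Right.der f) (H1Right.der g) := rfl

theorem der_injective : Function.Injective H1Right.der :=
  (injective_iff_map_eq_zero _).2 H1Right.eq_zero_of_der_eq_zero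

/-- The element of `H¹₍₁₎(0,1)` with weak derivative `h`. -/
noncomputable def ofDer (h : L2) : H1Right :=
  ⟨toL2 h.continuousOn_primitive, ⟨h, h.hasWeakDeriv_primitive⟩, h.primitive,
    h.continuousOn_primitive, coeFn_toL2 _, h.primitive_one⟩

theorem der_ofDer (h : L2) : H1Right.der (ofDer h) = h :=
  (H1Right.hasWeakDeriv _).unique h.hasWeakDeriv_primitive

/-- Differentiation is an isometry of `H¹₍₁₎(0,1)` onto `L²(0,1)`. -/
noncomputable def derIsometry : H1Right ≃ₗᵢ[ℝ] L2 :=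
  .ofSurjective (H1Right.der.isometryOfInner fun _ _ => rfl) fun h => ⟨ofDer h, der_ofDer h⟩

instance : CompleteSpace H1Right := derIsometry.toIsometryEquiv.completeSpace_iff.2 inferInstance

theorem val_ae_eq_primitive (f : H1Right) :
    H1Right.val f =ᵐ[unitMeasure] (H1Right.der f).primitive := by
  conv_lhs => rw [← der_injective (der_ofDer (H1Right.der f))]
  exact coeFn_toL2 (H1Right.der f).continuousOn_primitive

theorem integral_val_mul_deriv (f : H1Right) {φ : ℝ → ℝ} (hφ : ContDiff ℝ 1 φ) (hφ0 : φ 0 = 0) :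
    ∫ x in Ioo (0 : ℝ) 1, H1Right.val f x * deriv φ x =
      -∫ x in Ioo (0 : ℝ) 1, H1Right.der f x * φ x := by
  rw [integral_congr_mul_ae f.val_ae_eq_primitive]
  exact L2.integral_primitive_mul_deriv _ hφ.contDiffOn.absolutelyContinuousOnInterval hφ0

/-- The class in `H¹₍₁₎(0,1)` of a `C¹` function that vanishes at `1`. -/
noncomputable def ofContDiff {F : ℝ → ℝ} (hF : ContDiff ℝ 1 F) (hF1 : F 1 = 0) : H1Right :=
  ⟨toL2 hF.continuous.continuousOn, ⟨_, hasWeakDeriv_toL2 hF⟩, F, hF.continuous.continuousOn,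
    coeFn_toL2 _, hF1⟩

variable {F : ℝ → ℝ} (hF : ContDiff ℝ 1 F) (hF1 : F 1 = 0)

theorem val_ofContDiff_ae_eq : H1Right.val (ofContDiff hF hF1) =ᵐ[unitMeasure] F :=
  coeFn_toL2 hF.continuous.continuousOn

theorem der_ofContDiff :
    H1Right.der (ofContDiff hF hF1) = toL2 (hF.continuous_deriv le_rfl).continuousOn :=
  (H1Right.hasWeakDeriv _).unique (hasWeakDeriv_toL2 hF)

theorem norm_ofContDiff_le {C : ℝ} (hC : ∀ x ∈ Icc (0 : ℝ) 1, |deriv F x| ≤ C) :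
    ‖ofContDiff hF hF1‖ ≤ C := by
  rw [← derIsometry.norm_map]
  change ‖H1Right.der _‖ ≤ C
  rw [der_ofContDiff]
  exact norm_toL2_le _ hC

end H1Right

/-- Weak form of the eigenvalue problem `-F'' = κF` with the mixed boundary conditions
`F'(0) = F(1) = 0`. -/
theorem H1Right.inner_ofContDiff_of_deriv_deriv_eq {F : ℝ → ℝ} (hF : ContDiff ℝ 2 F) {κ : ℝ}
    (hκ : ∀ x, deriv (deriv F) x = -κ * F x) (h0 : deriv F 0 = 0) (h1 : F 1 = 0) (f : H1Right) :
    inner ℝ (H1Right.ofContDiff (hF.of_le one_le_two) h1) f =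
      κ * ∫ x in Ioo (0 : ℝ) 1, H1Right.val f x * F x := by
  have hF' : ContDiff ℝ 1 (deriv F) := (contDiff_succ_iff_deriv.1 hF).2.2
  have hparts := f.integral_val_mul_deriv hF' h0
  simp only [hκ, mul_left_comm _ (-κ), integral_const_mul] at hparts
  rw [H1Right.inner_eq, H1Right.der_ofContDiff, L2.inner_eq_integral,
    integral_congr_mul_ae (coeFn_toL2 _)]
  simp only [mul_comm (deriv F _)]
  linarith

/-! ### The two cosine bases -/

theorem integral_cos_int_mul_pi (k : ℤ) :
    ∫ x in Ioo (0 : ℝ) 1, cos (k * π * x) = if k = 0 then 1 else 0 := by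
  rw [integral_unitMeasure_eq_intervalIntegral]
  split_ifs with hk
  · simp [hk]
  · have hkπ : (k : ℝ) * π ≠ 0 := mul_ne_zero (Int.cast_ne_zero.2 hk) pi_ne_zero
    simp [intervalIntegral.integral_comp_mul_left _ hkπ]

theorem integral_cos_mul_cos {α β : ℝ} {j k : ℤ} (hj : α - β = j * π) (hk : α + β = k * π) :
    ∫ x in Ioo (0 : ℝ) 1, cos (α * x) * cos (β * x) =
      ((if j = 0 then 1 else 0) + if k = 0 then 1 else 0) / 2 := by
  have hint (l : ℤ) : Integrable (fun x => cos (l * π * x)) unitMeasure :=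
    (memLp_unitMeasure_of_continuousOn
      (by fun_prop : Continuous fun x => cos (l * π * x)).continuousOn).integrable one_le_two
  have hprod (x : ℝ) : cos (α * x) * cos (β * x) = (cos (j * π * x) + cos (k * π * x)) / 2 := by
    rw [← hj, ← hk, sub_mul, add_mul, ← two_mul_cos_mul_cos]
    ring
  simp only [hprod]
  rw [integral_div, integral_add (hint j) (hint k), integral_cos_int_mul_pi,
    integral_cos_int_mul_pi]

section ConstMulCos

variable (c α : ℝ)

theorem contDiff_const_mul_cos {n : WithTop ℕ∞} : ContDiff ℝ n fun x => c * cos (α * x) := by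
  fun_prop

theorem deriv_const_mul_cos :
    deriv (fun x => c * cos (α * x)) = fun x => -(c * α) * sin (α * x) := by
  ext x
  have hlin : HasDerivAt (fun x => α * x) α x := by simpa using (hasDerivAt_id x).const_mul α
  rw [(hlin.cos.const_mul c).deriv]
  ring

theorem deriv_deriv_const_mul_cos (x : ℝ) :
    deriv (deriv fun x => c * cos (α * x)) x = -α ^ 2 * (c * cos (α * x)) := by
  have hlin : HasDerivAt (fun x => α * x) α x := by simpa using (hasDerivAt_id x).const_mul α
  rw [deriv_const_mul_cos, (hlin.sin.const_mul _).deriv]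
  ring

theorem deriv_const_mul_cos_zero : deriv (fun x => c * cos (α * x)) 0 = 0 := by
  simp only [deriv_const_mul_cos, mul_zero, sin_zero]

end ConstMulCos

theorem cos_natCast_add_half_mul_pi (n : ℕ) : cos ((n + 1 / 2) * π) = 0 :=
  cos_eq_zero_iff.2 ⟨n, by push_cast; ring⟩

/-- The class of `√2 cos((n+1/2)πx)` in `H¹₍₁₎(0,1)`. -/
noncomputable def mixedMode (n : ℕ) : H1Right :=
  .ofContDiff (contDiff_const_mul_cos √2 ((n + 1 / 2) * π))
    (by rw [mul_one, cos_natCast_add_half_mul_pi, mul_zero])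

theorem val_mixedMode (n : ℕ) :
    H1Right.val (mixedMode n) =ᵐ[unitMeasure] fun x => √2 * cos ((n + 1 / 2) * π * x) :=
  H1Right.val_ofContDiff_ae_eq _ _

theorem inner_mixedMode (n : ℕ) (f : H1Right) :
    inner ℝ (mixedMode n) f = ((n + 1 / 2) * π) ^ 2 *
      ∫ x in Ioo (0 : ℝ) 1, H1Right.val f x * (√2 * cos ((n + 1 / 2) * π * x)) :=
  H1Right.inner_ofContDiff_of_deriv_deriv_eq (contDiff_const_mul_cos _ _)
    (deriv_deriv_const_mul_cos _ _) (deriv_const_mul_cos_zero _ _) _ f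

theorem inner_mixedMode_mixedMode (n m : ℕ) :
    inner ℝ (mixedMode n) (mixedMode m) = if n = m then ((n + 1 / 2) * π) ^ 2 else 0 := by
  have horth : ∫ x in Ioo (0 : ℝ) 1, cos ((m + 1 / 2) * π * x) * cos ((n + 1 / 2) * π * x) =
      ((if (m - n : ℤ) = 0 then 1 else 0) + if (m + n + 1 : ℤ) = 0 then 1 else 0) / 2 :=
    integral_cos_mul_cos (by push_cast; ring) (by push_cast; ring)
  have hsqrt (x y : ℝ) : √2 * x * (√2 * y) = 2 * (x * y) := by
    rw [mul_mul_mul_comm, mul_self_sqrt zero_le_two]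
  rw [inner_mixedMode, integral_congr_mul_ae (val_mixedMode m)]
  simp only [hsqrt]
  rw [integral_const_mul, horth, if_neg (by omega : (m + n + 1 : ℤ) ≠ 0)]
  simp only [sub_eq_zero, Nat.cast_inj, @eq_comm _ m n]
  split_ifs <;> ring

theorem eq_zero_of_forall_inner_mixedMode_eq_zero {f : H1Right}
    (hf : ∀ n, inner ℝ (mixedMode n) f = 0) : f = 0 := by
  refine Subtype.ext (Lp.eq_zero_iff_ae_eq_zero.2 ?_)
  refine ae_eq_zero_of_integral_cos_add_half (Lp.memLp (H1Right.val f)) fun n => ?_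
  have hn := hf n
  simp only [inner_mixedMode, mul_left_comm _ √2, integral_const_mul] at hn
  have hfreq : ((n + 1 / 2 : ℝ) * π) ^ 2 ≠ 0 := by positivity
  exact (mul_eq_zero.1 ((mul_eq_zero.1 hn).resolve_left (by positivity))).resolve_left hfreq

/-- The Hilbert basis of `H¹₍₁₎(0,1)` of eigenfunctions for the mixed boundary conditions. -/
noncomputable def mixedBasis : HilbertBasis ℕ ℝ H1Right :=
  normalizedHilbertBasis inner_mixedMode_mixedMode (c := fun n => 1 / ((n + 1 / 2) * π))
    (fun n => by field_simp) fun _ => eq_zero_of_forall_inner_mixedMode_eq_zero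

theorem mixedBasis_apply (n : ℕ) : mixedBasis n = (1 / ((n + 1 / 2) * π) : ℝ) • mixedMode n :=
  normalizedHilbertBasis_apply ..

theorem mu_pos (m : ℕ) : 0 < mu m := by
  unfold mu
  split_ifs <;> positivity

theorem mu_sq (m : ℕ) : mu m ^ 2 = if m = 0 then 1 else 2 := by
  unfold mu
  split_ifs <;> norm_num

theorem cosMode_eq (m : ℕ) : cosMode m = fun x => mu m * cos (m * π * x) := by
  ext x
  by_cases hm : m = 0 <;> simp [cosMode, mu, hm]

/-- The class of `μ_m cos(mπx)` in `H¹(0,1)`. -/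
noncomputable def neumannMode (m : ℕ) : H1 :=
  .ofContDiff (contDiff_const_mul_cos (mu m) (m * π))

theorem val_neumannMode (m : ℕ) :
    H1.val (neumannMode m) =ᵐ[unitMeasure] cosMode m := by
  rw [cosMode_eq]
  exact H1.val_ofContDiff_ae_eq _

theorem inner_neumannMode (m : ℕ) (u : H1) :
    inner ℝ (neumannMode m) u = (1 + (m * π) ^ 2) *
      ∫ x in Ioo (0 : ℝ) 1, H1.val u x * (mu m * cos (m * π * x)) :=
  H1.inner_ofContDiff_of_deriv_deriv_eq (contDiff_const_mul_cos _ _)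
    (deriv_deriv_const_mul_cos _ _) (deriv_const_mul_cos_zero _ _)
    (by simp only [deriv_const_mul_cos, mul_one, sin_nat_mul_pi, mul_zero]) u

theorem inner_neumannMode_neumannMode (m n : ℕ) :
    inner ℝ (neumannMode m) (neumannMode n) = if m = n then 1 + (m * π) ^ 2 else 0 := by
  have horth : ∫ x in Ioo (0 : ℝ) 1, cos (n * π * x) * cos (m * π * x) =
      ((if (n - m : ℤ) = 0 then 1 else 0) + if (n + m : ℤ) = 0 then 1 else 0) / 2 :=
    integral_cos_mul_cos (by push_cast; ring) (by push_cast; ring)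
  rw [inner_neumannMode, integral_congr_mul_ae (val_neumannMode n), cosMode_eq]
  simp only [mul_mul_mul_comm (mu n)]
  rw [integral_const_mul, horth]
  rcases eq_or_ne m n with rfl | hmn
  · rw [if_pos rfl, if_pos (sub_self _), ← sq, mu_sq]
    rcases eq_or_ne m 0 with rfl | hm
    · norm_num
    · rw [if_neg hm, if_neg (by omega)]
      ring
  · rw [if_neg hmn, if_neg (by omega), if_neg (by omega)]
    ring

theorem eq_zero_of_forall_inner_neumannMode_eq_zero {u : H1}
    (hu : ∀ m, inner ℝ (neumannMode m) u = 0) : u = 0 := by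
  refine Subtype.ext (Lp.eq_zero_iff_ae_eq_zero.2 ?_)
  refine ae_eq_zero_of_integral_cos (Lp.memLp (H1.val u)) fun m => ?_
  have hm := hu m
  simp only [inner_neumannMode, mul_left_comm _ (mu m), integral_const_mul] at hm
  have hfreq : 1 + ((m : ℝ) * π) ^ 2 ≠ 0 := by positivity
  exact (mul_eq_zero.1 ((mul_eq_zero.1 hm).resolve_left (mu_pos m).ne')).resolve_left hfreq

/-- The Hilbert basis of `H¹(0,1)` of eigenfunctions for the Neumann boundary conditions. -/
noncomputable def neumannBasis : HilbertBasis ℕ ℝ H1 :=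
  normalizedHilbertBasis inner_neumannMode_neumannMode
    (c := fun m => 1 / √(1 + (m : ℝ) ^ 2 * π ^ 2))
    (fun m => by
      rw [div_pow, sq_sqrt (by positivity), one_pow, mul_pow, one_div_mul_cancel (by positivity)])
    fun _ => eq_zero_of_forall_inner_neumannMode_eq_zero

theorem neumannBasis_apply (m : ℕ) :
    neumannBasis m = (1 / √(1 + (m : ℝ) ^ 2 * π ^ 2)) • neumannMode m :=
  normalizedHilbertBasis_apply ..

/-! ### Bounds on the corrections -/

theorem Delta.two_mul_add_two_mul_add_one_le {a b : ℝ} {n m : ℕ} (h : (n, m) ∈ Delta a b) :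
    2 * (m : ℝ) + 2 * n + 1 ≤ |b - a| := by
  have hfactor : 4 * (b - a) = (2 * m - (2 * n + 1)) * (2 * m + 2 * n + 1) * π ^ 2 := by
    rw [show 4 * (b - a) = _ from h]
    ring
  have hodd : (1 : ℝ) ≤ |2 * (m : ℝ) - (2 * n + 1)| := by
    exact_mod_cast Int.one_le_abs (by omega : 2 * (m : ℤ) - (2 * n + 1) ≠ 0)
  have hpi : 4 ≤ π ^ 2 := by nlinarith [pi_gt_three]
  have habs := congrArg abs hfactor
  simp only [abs_mul, abs_pow, Nat.abs_ofNat, abs_of_pos pi_pos,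
    abs_of_pos (by positivity : (0 : ℝ) < 2 * m + 2 * n + 1)] at habs
  have : 1 * (2 * (m : ℝ) + 2 * n + 1) * 4 ≤
      |2 * (m : ℝ) - (2 * n + 1)| * (2 * m + 2 * n + 1) * π ^ 2 := by gcongr
  linarith

theorem notMem_Delta₁_of_abs_sub_le {a b : ℝ} {n : ℕ} (h : |b - a| ≤ n) : n ∉ Delta₁ a b := by
  rintro ⟨m, hm⟩
  linarith [Delta.two_mul_add_two_mul_add_one_le hm, n.cast_nonneg (α := ℝ), m.cast_nonneg (α := ℝ)]

theorem notMem_Delta₂_of_abs_sub_le {a b : ℝ} {m : ℕ} (h : |b - a| ≤ m) : m ∉ Delta₂ a b := by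
  rintro ⟨n, hn⟩
  linarith [Delta.two_mul_add_two_mul_add_one_le hn, n.cast_nonneg (α := ℝ), m.cast_nonneg (α := ℝ)]

theorem exists_eq_mul_I_of_sq_eq_sub_sq {r : ℂ} {c α : ℝ} (hr : r ^ 2 = ((c - α ^ 2 : ℝ) : ℂ))
    (hα : 1 + |c| ≤ α) : ∃ t : ℝ, r = t * Complex.I ∧ 1 ≤ |t| ∧ |(|t| - α)| ≤ 1 := by
  have hc := le_abs_self c
  have hc0 := abs_nonneg c
  rcases real_or_imaginary_of_sq hr with ⟨t, rfl⟩ | ⟨t, rfl⟩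
  · have hsq : t ^ 2 = c - α ^ 2 := by exact_mod_cast hr
    nlinarith [sq_nonneg t]
  · have hsq : -t ^ 2 = c - α ^ 2 := by
      rw [mul_pow, Complex.I_sq, mul_neg_one] at hr
      exact_mod_cast hr
    refine ⟨t, rfl, (one_le_sq_iff_one_le_abs t).1 (by nlinarith), ?_⟩
    have hpos : 0 < |t| + α := by linarith [abs_nonneg t]
    have hfactor : (|t| - α) * (|t| + α) = -c := by linear_combination sq_abs t - hsq
    have habs : |(|t| - α)| * (|t| + α) = |c| := by
      rw [← abs_of_pos hpos, ← abs_mul, hfactor, abs_neg]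
    exact le_of_mul_le_mul_right (by linarith [abs_nonneg t]) hpos

theorem half_le_abs_cos_of_abs_sub_nat_mul_pi_le {x : ℝ} {k : ℕ} (h : |x - k * π| ≤ 1) :
    1 / 2 ≤ |cos x| := by
  have hcos : |cos x| = |cos (x - k * π)| := by simp [cos_sub_nat_mul_pi, abs_mul]
  have hsq := (sq_le_one_iff_abs_le_one _).2 h
  rw [hcos]
  refine le_trans ?_ (le_abs_self _)
  linarith [one_sub_sq_div_two_le_cos (x := x - k * π)]

theorem half_le_abs_sin_of_abs_sub_nat_add_half_mul_pi_le {x : ℝ} {k : ℕ}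
    (h : |x - (k + 1 / 2) * π| ≤ 1) : 1 / 2 ≤ |sin x| := by
  rw [← cos_sub_pi_div_two]
  refine half_le_abs_cos_of_abs_sub_nat_mul_pi_le (k := k) ?_
  rwa [sub_sub, ← (by ring : (k + 1 / 2) * π = π / 2 + k * π)]

theorem exists_eq_mul_I_of_sq_eq_lambda₂ {a b : ℝ} {r : ℂ} {m : ℕ}
    (hr : r ^ 2 = ((lambda₂ b m - a : ℝ) : ℂ)) (hm : 1 + |b - a| ≤ m) :
    ∃ t : ℝ, r = t * Complex.I ∧ 1 ≤ |t| ∧ 1 / 2 ≤ |cos t| := by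
  have hmπ : (m : ℝ) ≤ m * π := le_mul_of_one_le_right m.cast_nonneg (by linarith [pi_gt_three])
  have hlambda : lambda₂ b m - a = b - a - (m * π) ^ 2 := by
    rw [lambda₂]
    ring
  obtain ⟨t, rfl, ht, htm⟩ := exists_eq_mul_I_of_sq_eq_sub_sq (hlambda ▸ hr) (hm.trans hmπ)
  exact ⟨t, rfl, ht, cos_abs t ▸ half_le_abs_cos_of_abs_sub_nat_mul_pi_le htm⟩

theorem exists_eq_mul_I_of_sq_eq_lambda₁ {a b : ℝ} {r : ℂ} {n : ℕ}
    (hr : r ^ 2 = ((lambda₁ a n - b : ℝ) : ℂ)) (hn : 1 + |b - a| ≤ n) :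
    ∃ t : ℝ, r = t * Complex.I ∧ 1 ≤ |t| ∧ 1 / 2 ≤ |sin t| := by
  have hnπ : (n : ℝ) ≤ (n + 1 / 2) * π := by
    nlinarith [pi_gt_three, n.cast_nonneg (α := ℝ)]
  have hlambda : lambda₁ a n - b = a - b - ((n + 1 / 2) * π) ^ 2 := by
    rw [lambda₁]
    ring
  obtain ⟨t, rfl, ht, htn⟩ := exists_eq_mul_I_of_sq_eq_sub_sq (hlambda ▸ hr)
    ((abs_sub_comm b a ▸ hn).trans hnπ)
  have habs : |sin t| = |sin (|t|)| := by
    rcases abs_choice t with h | h <;> simp [h]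
  exact ⟨t, rfl, ht, habs ▸ half_le_abs_sin_of_abs_sub_nat_add_half_mul_pi_le htn⟩

theorem contDiff_re_comp_ofReal {f : ℂ → ℂ} {n : WithTop ℕ∞} (hf : ContDiff ℂ n f) :
    ContDiff ℝ n fun x : ℝ => (f x).re :=
  Complex.reCLM.contDiff.comp ((hf.restrict_scalars ℝ).comp Complex.ofRealCLM.contDiff)

variable {a b s : ℝ}

theorem contDiff_phi₂Fst (a b s : ℝ) (r : ℂ) (m : ℕ) {k : WithTop ℕ∞} :
    ContDiff ℝ k (phi₂Fst a b s r m) := by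
  unfold phi₂Fst
  split_ifs
  · fun_prop
  · fun_prop
  · exact contDiff_re_comp_ofReal (f := fun z => -((s * mu m : ℝ) : ℂ) / (r * Complex.cosh r) *
      Complex.sinh (r * (1 - z))) (by fun_prop)

theorem phi₂Fst_one (a b s : ℝ) (r : ℂ) (m : ℕ) : phi₂Fst a b s r m 1 = 0 := by
  simp [phi₂Fst]

theorem phi₂Fst_mul_I {m : ℕ} {t : ℝ} (hm : m ∉ Delta₂ a b) (hab : b - a ≠ (m : ℝ) ^ 2 * π ^ 2)
    (x : ℝ) :
    phi₂Fst a b s (t * Complex.I) m x = -(s * mu m) / (t * cos t) * sin (t * (1 - x)) := by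
  rw [phi₂Fst, dif_neg hm, if_neg hab, mul_right_comm (t : ℂ) Complex.I (1 - x),
    Complex.cosh_mul_I, Complex.sinh_mul_I, mul_right_comm (t : ℂ) Complex.I, ← mul_assoc,
    div_mul_eq_mul_div, div_mul_eq_mul_div, mul_div_mul_right _ _ Complex.I_ne_zero]
  have hreal : -((s * mu m : ℝ) : ℂ) * Complex.sin (t * (1 - x)) / (t * Complex.cos t) =
      ((-(s * mu m) / (t * cos t) * sin (t * (1 - x)) : ℝ) : ℂ) := by
    push_cast
    ring
  rw [hreal, Complex.ofReal_re]

theorem deriv_phi₂Fst_mul_I {m : ℕ} {t : ℝ} (hm : m ∉ Delta₂ a b)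
    (hab : b - a ≠ (m : ℝ) ^ 2 * π ^ 2) (ht : t ≠ 0) (x : ℝ) :
    deriv (phi₂Fst a b s (t * Complex.I) m) x = s * mu m / cos t * cos (t * (1 - x)) := by
  have hlin : HasDerivAt (fun x => t * (1 - x)) (-t) x := by
    simpa using ((hasDerivAt_id x).const_sub 1).const_mul t
  rw [funext (phi₂Fst_mul_I hm hab), (hlin.sin.const_mul _).deriv]
  field_simp

theorem sq_le_sq_mul_pi_sq (x : ℝ) : x ^ 2 ≤ x ^ 2 * π ^ 2 :=
  le_mul_of_one_le_right (sq_nonneg x) (one_le_pow₀ (by linarith [pi_gt_three]))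

theorem abs_mu_le (m : ℕ) : |mu m| ≤ √2 :=
  abs_le_sqrt (by rw [mu_sq]; split_ifs <;> norm_num)

theorem abs_deriv_phi₂Fst_le {r : ℂ} {m : ℕ} (hr : r ^ 2 = ((lambda₂ b m - a : ℝ) : ℂ))
    (hm : 1 + |b - a| ≤ m) (x : ℝ) : |deriv (phi₂Fst a b s r m) x| ≤ 2 * √2 * |s| := by
  obtain ⟨t, rfl, ht, hcos⟩ := exists_eq_mul_I_of_sq_eq_lambda₂ hr hm
  have hab : b - a ≠ (m : ℝ) ^ 2 * π ^ 2 := by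
    intro h
    nlinarith [le_abs_self (b - a), abs_nonneg (b - a), sq_le_sq_mul_pi_sq m]
  rw [deriv_phi₂Fst_mul_I (notMem_Delta₂_of_abs_sub_le (by linarith)) hab
    (abs_pos.1 (by linarith)), abs_mul, abs_div, abs_mul]
  calc |s| * |mu m| / |cos t| * |cos (t * (1 - x))| ≤ |s| * √2 / (1 / 2) * 1 := by
        gcongr
        · exact abs_mu_le m
        · exact abs_cos_le_one _
    _ = 2 * √2 * |s| := by ring

/-- The class of the first component of `φ_{2,m}` in `H¹₍₁₎(0,1)`. -/
noncomputable def phiCorrection (a b s : ℝ) (r : ℂ) (m : ℕ) : H1Right :=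
  .ofContDiff (contDiff_phi₂Fst a b s r m) (phi₂Fst_one a b s r m)

theorem isBigO_phiCorrection {r : ℕ → ℂ} (hr : ∀ m, r m ^ 2 = ((lambda₂ b m - a : ℝ) : ℂ)) :
    (fun m => phiCorrection a b s (r m) m) =O[atTop] fun _ => (1 : ℝ) := by
  refine .of_bound (2 * √2 * |s|) ?_
  filter_upwards [tendsto_natCast_atTop_atTop.eventually_ge_atTop (1 + |b - a|)] with m hm
  simpa [phiCorrection] using
    H1Right.norm_ofContDiff_le _ _ fun x _ => abs_deriv_phi₂Fst_le (hr m) hm x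

theorem contDiff_psi₁Snd (a b s : ℝ) (r : ℂ) (n : ℕ) {k : WithTop ℕ∞} :
    ContDiff ℝ k (psi₁Snd a b s r n) := by
  unfold psi₁Snd
  split_ifs
  · fun_prop
  · fun_prop
  · exact contDiff_re_comp_ofReal (f := fun z => -((√2 * s : ℝ) : ℂ) / (r * Complex.sinh r) *
      Complex.cosh (r * (1 - z))) (by fun_prop)

theorem psi₁Snd_mul_I {n : ℕ} {t : ℝ} (hn : n ∉ Delta₁ a b) (x : ℝ) :
    psi₁Snd a b s (t * Complex.I) n x = √2 * s / (t * sin t) * cos (t * (1 - x)) := by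
  rw [psi₁Snd, dif_neg hn, mul_right_comm (t : ℂ) Complex.I (1 - x), Complex.cosh_mul_I,
    Complex.sinh_mul_I, mul_mul_mul_comm, Complex.I_mul_I, mul_neg_one, neg_div_neg_eq]
  have hreal : ((√2 * s : ℝ) : ℂ) / (t * Complex.sin t) * Complex.cos (t * (1 - x)) =
      ((√2 * s / (t * sin t) * cos (t * (1 - x)) : ℝ) : ℂ) := by
    push_cast
    ring
  rw [hreal, Complex.ofReal_re]

theorem deriv_psi₁Snd_mul_I {n : ℕ} {t : ℝ} (hn : n ∉ Delta₁ a b) (ht : t ≠ 0) (x : ℝ) :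
    deriv (psi₁Snd a b s (t * Complex.I) n) x = √2 * s / sin t * sin (t * (1 - x)) := by
  have hlin : HasDerivAt (fun x => t * (1 - x)) (-t) x := by
    simpa using ((hasDerivAt_id x).const_sub 1).const_mul t
  rw [funext (psi₁Snd_mul_I hn), (hlin.cos.const_mul _).deriv]
  field_simp

theorem abs_psi₁Snd_le {r : ℂ} {n : ℕ} (hr : r ^ 2 = ((lambda₁ a n - b : ℝ) : ℂ))
    (hn : 1 + |b - a| ≤ n) (x : ℝ) : |psi₁Snd a b s r n x| ≤ 2 * √2 * |s| := by
  obtain ⟨t, rfl, ht, hsin⟩ := exists_eq_mul_I_of_sq_eq_lambda₁ hr hn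
  rw [psi₁Snd_mul_I (notMem_Delta₁_of_abs_sub_le (by linarith)), abs_mul, abs_div, abs_mul,
    abs_mul, abs_of_nonneg (sqrt_nonneg 2)]
  calc √2 * |s| / (|t| * |sin t|) * |cos (t * (1 - x))| ≤ √2 * |s| / (1 * (1 / 2)) * 1 := by
        gcongr
        exact abs_cos_le_one _
    _ = 2 * √2 * |s| := by ring

theorem abs_deriv_psi₁Snd_le {r : ℂ} {n : ℕ} (hr : r ^ 2 = ((lambda₁ a n - b : ℝ) : ℂ))
    (hn : 1 + |b - a| ≤ n) (x : ℝ) : |deriv (psi₁Snd a b s r n) x| ≤ 2 * √2 * |s| := by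
  obtain ⟨t, rfl, ht, hsin⟩ := exists_eq_mul_I_of_sq_eq_lambda₁ hr hn
  rw [deriv_psi₁Snd_mul_I (notMem_Delta₁_of_abs_sub_le (by linarith)) (abs_pos.1 (by linarith)),
    abs_mul, abs_div, abs_mul, abs_of_nonneg (sqrt_nonneg 2)]
  calc √2 * |s| / |sin t| * |sin (t * (1 - x))| ≤ √2 * |s| / (1 / 2) * 1 := by
        gcongr
        exact abs_sin_le_one _
    _ = 2 * √2 * |s| := by ring

/-- The class of the second component of `ψ_{1,n}` in `H¹(0,1)`. -/
noncomputable def psiCorrection (a b s : ℝ) (r : ℂ) (n : ℕ) : H1 :=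
  .ofContDiff (contDiff_psi₁Snd a b s r n)

theorem isBigO_psiCorrection {r : ℕ → ℂ} (hr : ∀ n, r n ^ 2 = ((lambda₁ a n - b : ℝ) : ℂ)) :
    (fun n => psiCorrection a b s (r n) n) =O[atTop] fun _ => (1 : ℝ) := by
  refine .of_bound (2 * √2 * |s| + 2 * √2 * |s|) ?_
  filter_upwards [tendsto_natCast_atTop_atTop.eventually_ge_atTop (1 + |b - a|)] with n hn
  simpa [psiCorrection] using H1.norm_ofContDiff_le _ (fun x _ => abs_psi₁Snd_le (hr n) hn x)
    fun x _ => abs_deriv_psi₁Snd_le (hr n) hn x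

/-! ### The two families -/

theorem isBigO_mixed_normalization :
    (fun n : ℕ => 1 / (((n : ℝ) + 1 / 2) * π)) =O[atTop] fun n => (n : ℝ)⁻¹ := by
  refine .of_bound 1 ?_
  filter_upwards [eventually_gt_atTop 0] with n hn
  have hnπ : (n : ℝ) ≤ (n + 1 / 2) * π := by nlinarith [pi_gt_three, n.cast_nonneg (α := ℝ)]
  rw [one_div, one_mul, norm_inv, norm_inv, Real.norm_natCast, norm_of_nonneg (by positivity)]
  gcongr

theorem isBigO_neumann_normalization :
    (fun m : ℕ => 1 / √(1 + (m : ℝ) ^ 2 * π ^ 2)) =O[atTop] fun m => (m : ℝ)⁻¹ := by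
  refine .of_bound 1 ?_
  filter_upwards [eventually_gt_atTop 0] with m hm
  have hmπ : (m : ℝ) ≤ √(1 + (m : ℝ) ^ 2 * π ^ 2) :=
    le_sqrt_of_sq_le (by linarith [sq_le_sq_mul_pi_sq m])
  rw [one_div, one_mul, norm_inv, norm_inv, Real.norm_natCast, norm_of_nonneg (by positivity)]
  gcongr

theorem HSpace.IsClassOf.smul {u : HSpace} {p : (ℝ → ℝ) × (ℝ → ℝ)} (h : u.IsClassOf p) (c : ℝ) :
    (c • u).IsClassOf (c • p) := by
  have hfst : H1Right.val (c • u).fst =ᵐ[unitMeasure] c • H1Right.val u.fst := by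
    rw [WithLp.smul_fst, map_smul]
    exact Lp.coeFn_smul c _
  have hsnd : H1.val (c • u).snd =ᵐ[unitMeasure] c • H1.val u.snd := by
    rw [WithLp.smul_snd, map_smul]
    exact Lp.coeFn_smul c _
  exact ⟨hfst.trans (h.1.const_smul c), hsnd.trans (h.2.const_smul c)⟩

/-- The rescaled `φ`-family as a family of elements of `H¹₍₁₎(0,1) × H¹(0,1)`. -/
noncomputable def phiFamily (a b s : ℝ) (r : ℕ → ℂ) : ℕ ⊕ ℕ → HSpace :=
  Sum.elim (fun n => (1 / (((n : ℝ) + 1 / 2) * π)) • WithLp.toLp 2 (mixedMode n, 0)) fun m =>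
    (1 / √(1 + (m : ℝ) ^ 2 * π ^ 2)) • WithLp.toLp 2 (phiCorrection a b s (r m) m, neumannMode m)

/-- The rescaled `ψ`-family as a family of elements of `H¹₍₁₎(0,1) × H¹(0,1)`. -/
noncomputable def psiFamily (a b s : ℝ) (r : ℕ → ℂ) : ℕ ⊕ ℕ → HSpace :=
  Sum.elim
    (fun n => (1 / (((n : ℝ) + 1 / 2) * π)) •
      WithLp.toLp 2 (mixedMode n, psiCorrection a b s (r n) n))
    fun m => (1 / √(1 + (m : ℝ) ^ 2 * π ^ 2)) • WithLp.toLp 2 (0, neumannMode m)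

theorem isClassOf_phiFamily (r : ℕ → ℂ) (i : ℕ ⊕ ℕ) :
    (phiFamily a b s r i).IsClassOf (rescaled phi₁ (fun m => phi₂ a b s (r m) m) i) := by
  rcases i with n | m
  · have hclass : HSpace.IsClassOf (WithLp.toLp 2 (mixedMode n, 0)) (phi₁ n) :=
      ⟨val_mixedMode n, Lp.coeFn_zero ..⟩
    exact hclass.smul _
  · have hclass : HSpace.IsClassOf (WithLp.toLp 2 (phiCorrection a b s (r m) m, neumannMode m))
        (phi₂ a b s (r m) m) :=
      ⟨H1Right.val_ofContDiff_ae_eq (contDiff_phi₂Fst ..) (phi₂Fst_one ..), val_neumannMode m⟩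
    exact hclass.smul _

theorem isClassOf_psiFamily (r : ℕ → ℂ) (i : ℕ ⊕ ℕ) :
    (psiFamily a b s r i).IsClassOf (rescaled (fun n => psi₁ a b s (r n) n) psi₂ i) := by
  rcases i with n | m
  · have hclass : HSpace.IsClassOf (WithLp.toLp 2 (mixedMode n, psiCorrection a b s (r n) n))
        (psi₁ a b s (r n) n) :=
      ⟨val_mixedMode n, H1.val_ofContDiff_ae_eq (contDiff_psi₁Snd ..)⟩
    exact hclass.smul _
  · have hclass : HSpace.IsClassOf (WithLp.toLp 2 (0, neumannMode m)) (psi₂ m) :=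
      ⟨Lp.coeFn_zero .., val_neumannMode m⟩
    exact hclass.smul _

theorem isRieszBasis_phiFamily {r : ℕ → ℂ}
    (hr : ∀ m, r m ^ 2 = ((lambda₂ b m - a : ℝ) : ℂ)) : IsRieszBasis (phiFamily a b s r) := by
  have hw := memlp_smul_of_isBigO isBigO_neumann_normalization (isBigO_phiCorrection (s := s) hr)
  convert isRieszBasis_sum_upper mixedBasis neumannBasis ⟨_, hw⟩ using 1
  simp only [mixedBasis_apply, neumannBasis_apply]
  ext (n | m) <;> simp [phiFamily, ← WithLp.toLp_smul]

theorem isRieszBasis_psiFamily {r : ℕ → ℂ}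
    (hr : ∀ n, r n ^ 2 = ((lambda₁ a n - b : ℝ) : ℂ)) : IsRieszBasis (psiFamily a b s r) := by
  have hw := memlp_smul_of_isBigO isBigO_mixed_normalization (isBigO_psiCorrection (s := s) hr)
  convert isRieszBasis_sum_lower mixedBasis neumannBasis ⟨_, hw⟩ using 1
  simp only [mixedBasis_apply, neumannBasis_apply]
  ext (n | m) <;> simp [psiFamily, ← WithLp.toLp_smul]

end HeatCascade

theorem mainTheorem8 (a b s : ℝ) (hs : s ≠ 0) (r r' : ℕ → ℂ)
    (hr : ∀ m, r m ^ 2 = ((HeatCascade.lambda₂ b m - a : ℝ) : ℂ))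
    (hr' : ∀ n, r' n ^ 2 = ((HeatCascade.lambda₁ a n - b : ℝ) : ℂ)) :
    (∃ Φ : ℕ ⊕ ℕ → HeatCascade.HSpace,
      (∀ i, (Φ i).IsClassOf (HeatCascade.rescaled HeatCascade.phi₁
        (fun m => HeatCascade.phi₂ a b s (r m) m) i)) ∧
      HeatCascade.IsRieszBasis Φ) ∧
    (∃ Ψ : ℕ ⊕ ℕ → HeatCascade.HSpace,
      (∀ i, (Ψ i).IsClassOf (HeatCascade.rescaled
        (fun n => HeatCascade.psi₁ a b s (r' n) n) HeatCascade.psi₂ i)) ∧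
      HeatCascade.IsRieszBasis Ψ) :=
  ⟨⟨HeatCascade.phiFamily a b s r, HeatCascade.isClassOf_phiFamily r,
      HeatCascade.isRieszBasis_phiFamily hr⟩,
    ⟨HeatCascade.psiFamily a b s r', HeatCascade.isClassOf_psiFamily r',
      HeatCascade.isRieszBasis_psiFamily hr'⟩⟩
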